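/- Let $\Pi=\mathbb{R}\times\mathbb{R}_+$ be the upper half-plane, $\mathbb{R}_+=(0,\infty)$, and let $q\in[1,\infty)$. Let $\mathcal{D}'=\mathcal{S}(\mathbb{R})'\hat\otimes C_c^\infty(\mathbb{R}_+)'$ be the space of distributions $u(x,y)$ on $\Pi$ that are tempered in $x$, and let $\mathfrak{F}u=\hat u$ be the partial Fourier transform in $x$, $\hat u(\xi,y)=\int u(x,y)e^{-2\pi i x\xi}dx$, extended to $\mathcal{D}'$ by duality. Let $X$ be a complex Banach space of distributions uniformly embedded in $C_c^\infty(\mathbb{R}_+)'$: there is a continuous seminorm $P$ on $C_c^\infty(\mathbb{R}_+)$ with $|\langle f,\psi\rangle|\le\|f\|_X P(\psi)$ for all $f\in X$ and all $\psi$. Set $$\mathcal{L}^{q;X}(\Pi)=\{u\in\mathcal{D}' : \hat u\in L^q(\mathbb{R},X)\},\quad \|u\|=\Big(\int_{\mathbb{R}}\|\hat u(\xi)\|_X^q\,d\xi\Big)^{1/q},\qquad \mathcal{A}^{q;X}(\Pi)=\mathcal{L}^{q;X}(\Pi)\cap\mathrm{Hol}(\Pi),$$ where $L^q(\mathbb{R},X)$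 consists of classes of Bochner-measurable functions. Let $\rho(\xi)=\|e^{-2\pi\xi\,\cdot}\|_X\in(0,\infty]$, with $\rho(\xi)=\infty$ if $e^{-2\pi\xi\,\cdot}\notin X$, and $1/\infty=0$. Let $$\Xi(\rho)=\{g\in L^1_{loc}(\mathbb{R}) : g\rho\in L^q(\mathbb{R})\},\qquad \|g\|_{\Xi,\rho}=\|g\rho\|_q ,$$ where $g\rho\in L^q$ entails $g=0$ a.e. on $\{\rho=\infty\}$. Then: 1. $\mathfrak{F}$ is an isometric isomorphism of $\mathcal{L}^{q;X}(\Pi)$ onto $L^q(\mathbb{R},X)$. 2. If $1/\rho\in L^\infty_{loc}(\mathbb{R})$, then $\Xi(\rho)$ is complete. 3. For every $u\in\mathcal{A}^{q;X}(\Pi)$ there is a unique $\hat u_0\in\Xi(\rho)$ with $\hat u(\xi,y)=e^{-2\pi\xi y}\hat u_0(\xi)$ for almost every $\xi$. If the map $\xi\mapsto e^{-2\pi\xi\,\cdot}/\rho(\xi)\in X$ equals a.e. a Bochner-measurable function, then $u\mapsto\hat u_0$ is an isometric isomorphism of $\mathcal{A}^{q;X}(\Pi)$ onto $\Xi(\rho)$;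 that is, $\mathfrak{F}$ maps $\mathcal{A}^{q;X}(\Pi)$ isometrically and isomorphically onto $e^{-2\pi\xi y}\,\Xi(\rho)$. If moreover $1/\rho\in L^\infty_{loc}(\mathbb{R})$, then $\mathcal{A}^{q;X}(\Pi)$ is complete. 4. Suppose $\rho(\xi)=\infty$ for a.e. $\xi<0$. Then $\mathrm{supp}\,\hat u_0\subset[0,\infty)$ for all $u\in\mathcal{A}^{q;X}(\Pi)$. If in addition $e^{-2\pi y_0\,\cdot}/\rho\in L^\infty(\mathbb{R})$ for some $y_0\ge0$, then $\sup_{y>y_1}\|u(\cdot,y)\|_\infty<\infty$ for all $u\in\mathcal{A}^{q;X}(\Pi)$ and all $y_1>y_0$. 5. Let $\lambda>-1$, $p\in[1,\infty)$, $d\nu_\lambda(y)=(\lambda+1)(2y)^\lambda dy$ and $X=L^p(\mathbb{R}_+,\nu_\lambda)$, where $f\in X$ is identified with the distribution $\psi\mapsto\int_0^\infty f\psi\,dy$. This is a uniform embedding, $$\rho(\xi)=\xi^{-\frac{\lambda+1}{p}}\left(\frac{2^\lambda\,\Gamma(\lambda+2)}{(2\pi p)^{\lambda+1}}\right)^{1/p}\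 (\xi>0),\qquad \rho(\xi)=+\infty\ (\xi\le0),$$ the function $1/\rho$ is continuous on $\mathbb{R}$ (so $1/\rho\in L^\infty_{loc}$), the map $\xi\mapsto e^{-2\pi\xi\,\cdot}/\rho(\xi)\in X$ is continuous on $\mathbb{R}\setminus\{0\}$ and a.e. equal to a Bochner-measurable function, and $e^{-2\pi y_0\,\cdot}/\rho\in L^\infty(\mathbb{R})$ for every $y_0>0$. Hence all the conclusions of 1--4 hold for this $X$, with the boundedness property for every $y_1>0$. -/

import Mathlib

open MeasureTheory Set Filter Topology TopologicalSpace
open scoped ENNReal NNReal Distributions SchwartzMap FourierTransform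

noncomputable section

namespace MixedFourier

/-- The half-line `ℝ₊ = (0, ∞)` as an open subset of `ℝ`. -/
def posHalfLine : Opens ℝ := ⟨Ioi 0, isOpen_Ioi⟩

/-- The space `𝓢(ℝ)' ⊗̂ C_c^∞(ℝ₊)'` of distributions `u(x, y)` on the half-plane `ℝ × ℝ₊` that are
tempered in `x`, realised through `𝓢(ℝ)' ⊗̂ C_c^∞(ℝ₊)' = L(𝓢(ℝ), C_c^∞(ℝ₊)')`: the value of
`u` on the test function `φ(x) ψ(y)` is `u φ ψ`. -/
abbrev SemiTempered : Type := 𝓢(ℝ, ℂ) →L[ℂ] 𝓓'(posHalfLine, ℂ)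

/-- The partial Fourier transform in `x`, extended to distributions by duality:
`⟨û, φ ⊗ ψ⟩ = ⟨u, φ̂ ⊗ ψ⟩` with `φ̂ ξ = ∫ φ(x) e^{-2πixξ} dx`. -/
def partialFourier (u : SemiTempered) : SemiTempered :=
  u ∘L (FourierTransform.fourierCLM ℂ 𝓢(ℝ, ℂ))

/-- A uniform embedding of the normed space `X` into the space of distributions on `ℝ₊`. -/
structure UniformEmbedding (X : Type*) [NormedAddCommGroup X] [NormedSpace ℂ X] where
  toDist : X →ₗ[ℂ] 𝓓'(posHalfLine, ℂ)
  injective : Function.Injective toDist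
  bound : ∃ p : Seminorm ℝ 𝓓(posHalfLine, ℝ), Continuous p ∧
    ∀ (x : X) (ψ : 𝓓(posHalfLine, ℝ)), ‖toDist x ψ‖ ≤ ‖x‖ * p ψ

variable {X : Type*} [NormedAddCommGroup X] [NormedSpace ℂ X]

/-- The distribution `T` on `ℝ × ℝ₊` is given by the `X`-valued function `f` of `ξ`. -/
def IsGivenBy (ι : UniformEmbedding X) (T : SemiTempered) (f : ℝ → X) : Prop :=
  ∀ (φ : 𝓢(ℝ, ℂ)) (ψ : 𝓓(posHalfLine, ℝ)), T φ ψ = ∫ ξ, φ ξ * ι.toDist (f ξ) ψ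

/-- Evaluation against a fixed test function is a continuous linear functional on `X`. -/
def UniformEmbedding.evalCLM (ι : UniformEmbedding X) (ψ : 𝓓(posHalfLine, ℝ)) : X →L[ℂ] ℂ :=
  LinearMap.mkContinuousOfExistsBound
    { toFun := fun x => ι.toDist x ψ
      map_add' := fun x y => by simp
      map_smul' := fun c x => by simp }
    (by
      obtain ⟨p, -, hp⟩ := ι.bound
      exact ⟨p ψ, fun x => by simpa [mul_comm] using hp x ψ⟩)

@[simp] theorem UniformEmbedding.evalCLM_apply (ι : UniformEmbedding X) (ψ : 𝓓(posHalfLine, ℝ))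
    (x : X) : ι.evalCLM ψ x = ι.toDist x ψ := rfl

theorem integrable_pairing (ι : UniformEmbedding X) {q : ℝ≥0∞} [Fact (1 ≤ q)]
    (f : Lp X q (volume : Measure ℝ)) (φ : 𝓢(ℝ, ℂ)) (ψ : 𝓓(posHalfLine, ℝ)) :
    Integrable (fun ξ => φ ξ * ι.toDist (f ξ) ψ) := by
  have h1 : MemLp (fun ξ => ι.evalCLM ψ (f ξ)) q (volume : Measure ℝ) :=
    (ι.evalCLM ψ).comp_memLp f
  have h2 : MemLp φ (ENNReal.conjExponent q) (volume : Measure ℝ) := φ.memLp _ _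
  have : ENNReal.HolderConjugate (ENNReal.conjExponent q) q :=
    (ENNReal.HolderConjugate.conjExponent (Fact.out : 1 ≤ q)).symm
  exact h2.integrable_mul h1

theorem IsGivenBy.add {ι : UniformEmbedding X} {q : ℝ≥0∞} [Fact (1 ≤ q)] {S T : SemiTempered}
    {f g : Lp X q (volume : Measure ℝ)} (hS : IsGivenBy ι S f) (hT : IsGivenBy ι T g) :
    IsGivenBy ι (S + T) (f + g : Lp X q (volume : Measure ℝ)) := by
  intro φ ψ
  have : (S + T) φ ψ = S φ ψ + T φ ψ := by simp
  rw [this, hS, hT, ← integral_add (integrable_pairing ι f φ ψ) (integrable_pairing ι g φ ψ)]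
  refine integral_congr_ae ?_
  filter_upwards [Lp.coeFn_add f g] with ξ h
  rw [h, Pi.add_apply, map_add, ← mul_add]
  rfl

theorem IsGivenBy.smul {ι : UniformEmbedding X} {q : ℝ≥0∞} [Fact (1 ≤ q)] {T : SemiTempered}
    {f : Lp X q (volume : Measure ℝ)} (c : ℂ) (hT : IsGivenBy ι T f) :
    IsGivenBy ι (c • T) (c • f : Lp X q (volume : Measure ℝ)) := by
  intro φ ψ
  have : (c • T) φ ψ = c * T φ ψ := by simp
  rw [this, hT, ← integral_const_mul]
  refine integral_congr_ae ?_
  filter_upwards [Lp.coeFn_smul c f] with ξ h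
  rw [h, Pi.smul_apply, map_smul, mul_left_comm]
  rfl

theorem IsGivenBy.zero (ι : UniformEmbedding X) (q : ℝ≥0∞) :
    IsGivenBy ι 0 (0 : Lp X q (volume : Measure ℝ)) := by
  intro φ ψ
  have : ∀ᵐ ξ, φ ξ * ι.toDist ((0 : Lp X q (volume : Measure ℝ)) ξ) ψ = 0 := by
    filter_upwards [Lp.coeFn_zero X q (volume : Measure ℝ)] with ξ h
    rw [h, Pi.zero_apply, map_zero]
    exact mul_zero _
  rw [integral_eq_zero_of_ae this]
  simp

theorem IsGivenBy.ae_eq_zero {ι : UniformEmbedding X} {q : ℝ≥0∞} [Fact (1 ≤ q)]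
    {f : Lp X q (volume : Measure ℝ)} (h : IsGivenBy ι 0 f) : f = 0 := by
  have hψ : ∀ ψ : 𝓓(posHalfLine, ℝ), ∀ᵐ ξ, ι.evalCLM ψ (f ξ) = 0 := by
    intro ψ
    have hM : MemLp (fun ξ => ι.evalCLM ψ (f ξ)) q (volume : Measure ℝ) :=
      (ι.evalCLM ψ).comp_memLp f
    have hL : LocallyIntegrable (fun ξ => ι.evalCLM ψ (f ξ)) (volume : Measure ℝ) :=
      hM.locallyIntegrable Fact.out
    refine ae_eq_zero_of_integral_contDiff_smul_eq_zero hL fun g hg hgs => ?_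
    have hgc : HasCompactSupport (fun x => (g x : ℂ)) :=
      hgs.comp_left (g := fun t : ℝ => (t : ℂ)) Complex.ofReal_zero
    have hgd : ContDiff ℝ (⊤ : ℕ∞) (fun x => (g x : ℂ)) :=
      Complex.ofRealCLM.contDiff.comp hg
    let φ : 𝓢(ℝ, ℂ) := hgc.toSchwartzMap hgd
    have h1 : (0 : ℂ) = ∫ ξ, φ ξ * ι.toDist (f ξ) ψ := h φ ψ
    have hφ : ∀ ξ, φ ξ = (g ξ : ℂ) := fun ξ => rfl
    simp only [hφ] at h1
    simpa only [Complex.real_smul, UniformEmbedding.evalCLM_apply] using h1.symm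
  obtain ⟨t, ht, hft⟩ := (Lp.aestronglyMeasurable f).isSeparable_ae_range
  have : SeparableSpace (closure t) := ht.closure.separableSpace
  have : SecondCountableTopology (closure t) :=
    UniformSpace.secondCountable_of_separable _
  let U : 𝓓(posHalfLine, ℝ) → Set (closure t) := fun ψ => {x | ι.evalCLM ψ x ≠ 0}
  have hU : ∀ ψ, IsOpen (U ψ) := fun ψ =>
    isOpen_ne_fun ((ι.evalCLM ψ).continuous.comp continuous_subtype_val) continuous_const
  obtain ⟨T, hT, hTU⟩ := isOpen_iUnion_countable U hU
  have hall : ∀ᵐ ξ, ∀ ψ ∈ T, ι.evalCLM ψ (f ξ) = 0 :=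
    (ae_ball_iff hT).2 fun ψ _ => hψ ψ
  rw [Lp.eq_zero_iff_ae_eq_zero]
  filter_upwards [hall, hft] with ξ h1 h2
  by_contra hne
  have h3 : ι.toDist (f ξ) ≠ 0 := fun h0 => hne (ι.injective (h0.trans (map_zero _).symm))
  obtain ⟨ψ, hψ0⟩ : ∃ ψ, ι.toDist (f ξ) ψ ≠ 0 := by
    by_contra hcon
    push Not at hcon
    exact h3 (by ext ψ; exact hcon ψ)
  have hmem : (⟨f ξ, subset_closure h2⟩ : closure t) ∈ ⋃ ψ, U ψ := mem_iUnion.2 ⟨ψ, hψ0⟩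
  rw [← hTU] at hmem
  simp only [mem_iUnion] at hmem
  obtain ⟨ψ', hT', hne'⟩ := hmem
  exact hne' (h1 ψ' hT')

theorem IsGivenBy.unique {ι : UniformEmbedding X} {q : ℝ≥0∞} [Fact (1 ≤ q)] {T : SemiTempered}
    {f g : Lp X q (volume : Measure ℝ)} (hf : IsGivenBy ι T f) (hg : IsGivenBy ι T g) :
    f = g := by
  have h := hf.add (hg.smul (-1))
  have h0 : T + (-1 : ℂ) • T = 0 := by simp
  rw [h0] at h
  have := h.ae_eq_zero
  simpa [neg_smul, ← sub_eq_add_neg, sub_eq_zero] using this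

/-- The space `𝓛^{q;X}` of the distributions `u` on the half-plane whose partial Fourier
transform belongs to `L^q(ℝ, X)`, as a set of distributions. -/
def mixedSubmodule (ι : UniformEmbedding X) (q : ℝ≥0∞) [Fact (1 ≤ q)] :
    Submodule ℂ SemiTempered where
  carrier := {u | ∃ f : Lp X q (volume : Measure ℝ), IsGivenBy ι (partialFourier u) f}
  add_mem' := by
    rintro u v ⟨f, hf⟩ ⟨g, hg⟩
    exact ⟨f + g, by simpa [partialFourier] using hf.add hg⟩
  zero_mem' := ⟨0, by simpa [partialFourier] using IsGivenBy.zero ι q⟩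
  smul_mem' := by
    rintro c u ⟨f, hf⟩
    exact ⟨c • f, by simpa [partialFourier] using hf.smul c⟩

/-- The space `𝓛^{q;X}` as a type of its own, so that its only topology is that of its norm. -/
def MixedSpace (ι : UniformEmbedding X) (q : ℝ≥0∞) [Fact (1 ≤ q)] : Type :=
  mixedSubmodule ι q

instance (ι : UniformEmbedding X) (q : ℝ≥0∞) [Fact (1 ≤ q)] : AddCommGroup (MixedSpace ι q) :=
  inferInstanceAs (AddCommGroup (mixedSubmodule ι q))

instance (ι : UniformEmbedding X) (q : ℝ≥0∞) [Fact (1 ≤ q)] : Module ℂ (MixedSpace ι q) :=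
  inferInstanceAs (Module ℂ (mixedSubmodule ι q))

/-- The inclusion of `𝓛^{q;X}` into the distributions on the half-plane. -/
def MixedSpace.toDistribution {ι : UniformEmbedding X} {q : ℝ≥0∞} [Fact (1 ≤ q)] :
    MixedSpace ι q →ₗ[ℂ] SemiTempered :=
  (mixedSubmodule ι q).subtype

theorem MixedSpace.exists_isGivenBy {ι : UniformEmbedding X} {q : ℝ≥0∞} [Fact (1 ≤ q)]
    (u : MixedSpace ι q) :
    ∃ f : Lp X q (volume : Measure ℝ), IsGivenBy ι (partialFourier u.toDistribution) f :=
  Subtype.property (p := fun v => v ∈ mixedSubmodule ι q) u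

/-- The Fourier transform `𝔉 : 𝓛^{q;X} → L^q(ℝ, X)`. -/
def transform (ι : UniformEmbedding X) (q : ℝ≥0∞) [Fact (1 ≤ q)] :
    MixedSpace ι q →ₗ[ℂ] Lp X q (volume : Measure ℝ) where
  toFun u := u.exists_isGivenBy.choose
  map_add' u v := (u + v).exists_isGivenBy.choose_spec.unique
    (by simpa [partialFourier] using
      u.exists_isGivenBy.choose_spec.add v.exists_isGivenBy.choose_spec)
  map_smul' c u := (c • u).exists_isGivenBy.choose_spec.unique
    (by simpa [partialFourier] using u.exists_isGivenBy.choose_spec.smul c)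

theorem transform_spec (ι : UniformEmbedding X) (q : ℝ≥0∞) [Fact (1 ≤ q)] (u : MixedSpace ι q) :
    IsGivenBy ι (partialFourier u.toDistribution) (transform ι q u) :=
  u.exists_isGivenBy.choose_spec

theorem transform_injective (ι : UniformEmbedding X) (q : ℝ≥0∞) [Fact (1 ≤ q)] :
    Function.Injective (transform ι q) := by
  intro u v huv
  have hu := transform_spec ι q u
  have hv := transform_spec ι q v
  rw [huv] at hu
  have huv' : u.toDistribution = v.toDistribution := by
    refine ContinuousLinearMap.ext fun φ => ?_
    ext ψ
    have h := (hu (𝓕⁻ φ) ψ).trans (hv (𝓕⁻ φ) ψ).symm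
    simpa [partialFourier] using h
  exact Subtype.ext (p := fun v => v ∈ mixedSubmodule ι q) huv'

/-- The norm `‖u‖ = ‖û‖` of `L^q(ℝ, X)` on `𝓛^{q;X}`. -/
instance (ι : UniformEmbedding X) (q : ℝ≥0∞) [Fact (1 ≤ q)] :
    NormedAddCommGroup (MixedSpace ι q) :=
  NormedAddCommGroup.induced _ _ (transform ι q) (transform_injective ι q)

instance (ι : UniformEmbedding X) (q : ℝ≥0∞) [Fact (1 ≤ q)] :
    NormedSpace ℂ (MixedSpace ι q) :=
  NormedSpace.induced ℂ _ _ (transform ι q)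

/-- The open upper half-plane. -/
def upper : Set ℂ := {z | 0 < z.im}

/-- The distribution `u` on the half-plane, restricted to compactly supported test functions, is
the function `F(x + iy)`. -/
def IsFunction (u : SemiTempered) (F : ℂ → ℂ) : Prop :=
  ∀ φ : 𝓢(ℝ, ℂ), HasCompactSupport φ → ∀ ψ : 𝓓(posHalfLine, ℝ),
    u φ ψ = ∫ z in {z : ℝ × ℝ | 0 < z.2}, F (z.1 + z.2 * Complex.I) * (φ z.1 * (ψ z.2 : ℂ))

theorem integrable_function {F : ℂ → ℂ} (hF : DifferentiableOn ℂ F upper) {φ : 𝓢(ℝ, ℂ)}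
    (hφ : HasCompactSupport φ) (ψ : 𝓓(posHalfLine, ℝ)) :
    IntegrableOn (fun z : ℝ × ℝ => F (z.1 + z.2 * Complex.I) * (φ z.1 * (ψ z.2 : ℂ)))
      {z : ℝ × ℝ | 0 < z.2} := by
  have hK : IsCompact (tsupport φ ×ˢ tsupport ψ) :=
    IsCompact.prod hφ ψ.hasCompactSupport
  have hc : ContinuousOn
      (fun z : ℝ × ℝ => F (z.1 + z.2 * Complex.I) * (φ z.1 * (ψ z.2 : ℂ)))
      (tsupport φ ×ˢ tsupport ψ) := by
    refine ContinuousOn.mul (hF.continuousOn.comp (by fun_prop) fun z hz => ?_) ?_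
    · have : z.2 ∈ Ioi (0 : ℝ) := ψ.tsupport_subset hz.2
      simpa [upper] using this
    · have h1 := φ.continuous
      have h2 := ψ.continuous
      fun_prop
  have hI := hc.integrableOn_compact (μ := volume) hK
  refine Integrable.integrableOn ((integrableOn_iff_integrable_of_support_subset ?_).1 hI)
  intro z hz
  simp only [Function.mem_support, ne_eq, mul_eq_zero, not_or, Complex.ofReal_eq_zero] at hz
  exact ⟨subset_tsupport _ hz.2.1, subset_tsupport _ hz.2.2⟩

/-- The space `𝓐^{q;X}` of holomorphic elements of `𝓛^{q;X}`, with the norm of `𝓛^{q;X}`. -/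
def bergmanSpace (ι : UniformEmbedding X) (q : ℝ≥0∞) [Fact (1 ≤ q)] :
    Submodule ℂ (MixedSpace ι q) where
  carrier := {u | ∃ F : ℂ → ℂ, DifferentiableOn ℂ F upper ∧ IsFunction u.toDistribution F}
  add_mem' := by
    rintro u v ⟨F, hF, hu⟩ ⟨G, hG, hv⟩
    refine ⟨F + G, hF.add hG, fun φ hφ ψ => ?_⟩
    have h := integral_add (integrable_function hF hφ ψ) (integrable_function hG hφ ψ)
    rw [← hu φ hφ ψ, ← hv φ hφ ψ] at h
    simpa [add_mul] using h.symm
  zero_mem' := ⟨0, by fun_prop, fun φ _ ψ => by simp⟩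
  smul_mem' := by
    rintro c u ⟨F, hF, hu⟩
    refine ⟨c • F, hF.const_smul c, fun φ hφ ψ => ?_⟩
    have h := hu φ hφ ψ
    simp only [map_smul, Pi.smul_apply, smul_eq_mul, mul_assoc, integral_const_mul]
    simp [h]

/-- The pairing of the function `y ↦ e^{-2πξy}` on `ℝ₊` with a test function. -/
def expPairing (ξ : ℝ) (ψ : 𝓓(posHalfLine, ℝ)) : ℂ :=
  ∫ y in Ioi (0 : ℝ), (Real.exp (-(2 * Real.pi * ξ * y)) : ℂ) * (ψ y : ℂ)

/-- `x : X` is the function `e^{-2π⟨·,ξ⟩}`. -/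
def IsExp (ι : UniformEmbedding X) (ξ : ℝ) (x : X) : Prop :=
  ∀ ψ : 𝓓(posHalfLine, ℝ), ι.toDist x ψ = expPairing ξ ψ

/-- `ρ(ξ) = ‖e^{-2π⟨·,ξ⟩}‖_X`, which is `∞` if `e^{-2π⟨·,ξ⟩}` is not in `X`. The infimum is over
at most one `x`. -/
def rho (ι : UniformEmbedding X) (ξ : ℝ) : ℝ≥0∞ := ⨅ (x : X) (_ : IsExp ι ξ x), ‖x‖ₑ

open Classical in
/-- `e^{-2π⟨·,ξ⟩} / ρ(ξ)` as an element of `X`, which is zero where `ρ(ξ) = ∞`. -/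
def normalizedExp (ι : UniformEmbedding X) (ξ : ℝ) : X :=
  if h : ∃ x, IsExp ι ξ x then ((‖h.choose‖ : ℂ)⁻¹) • h.choose else 0

theorem exists_testFunction_expPairing_ne_zero (ξ : ℝ) :
    ∃ ψ : 𝓓(posHalfLine, ℝ), expPairing ξ ψ ≠ 0 := by
  let b : ContDiffBump (2 : ℝ) := ⟨1 / 2, 1, by norm_num, by norm_num⟩
  have hts : tsupport b ⊆ Ioi (0 : ℝ) := by
    rw [b.tsupport_eq]
    intro y hy
    rw [Metric.mem_closedBall, Real.dist_eq, abs_le] at hy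
    have : (-1 : ℝ) ≤ y - 2 := hy.1
    simp only [mem_Ioi]
    linarith
  let ψ : 𝓓(posHalfLine, ℝ) := ⟨b, b.contDiff, b.hasCompactSupport, hts⟩
  refine ⟨ψ, ?_⟩
  have hc : Continuous fun y : ℝ => Real.exp (-(2 * Real.pi * ξ * y)) * b y := by
    have := b.continuous
    fun_prop
  have hpos : 0 < ∫ y, Real.exp (-(2 * Real.pi * ξ * y)) * b y := by
    refine hc.integral_pos_of_hasCompactSupport_nonneg_nonzero (x := 2)
      b.hasCompactSupport.mul_left (fun y => mul_nonneg (Real.exp_pos _).le b.nonneg) ?_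
    have : b 2 = 1 := b.one_of_mem_closedBall (Metric.mem_closedBall_self (by norm_num))
    simp [this, (Real.exp_pos _).ne']
  have hset : ∫ y in Ioi (0 : ℝ), Real.exp (-(2 * Real.pi * ξ * y)) * b y =
      ∫ y, Real.exp (-(2 * Real.pi * ξ * y)) * b y := by
    refine setIntegral_eq_integral_of_forall_compl_eq_zero fun y hy => ?_
    rw [image_eq_zero_of_notMem_tsupport fun h => hy (hts h), mul_zero]
  have : expPairing ξ ψ =
      ((∫ y in Ioi (0 : ℝ), Real.exp (-(2 * Real.pi * ξ * y)) * b y : ℝ) : ℂ) := by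
    rw [← integral_complex_ofReal]
    simp only [expPairing, Complex.ofReal_mul]
    rfl
  rw [this, hset]
  exact_mod_cast hpos.ne'

theorem rho_ne_zero (ι : UniformEmbedding X) (ξ : ℝ) : rho ι ξ ≠ 0 := by
  by_cases h : ∃ x, IsExp ι ξ x
  · obtain ⟨x, hx⟩ := h
    have hle : ‖x‖ₑ ≤ rho ι ξ := by
      refine le_iInf₂ fun y hy => ?_
      have : x = y := ι.injective (by ext ψ; exact (hx ψ).trans (hy ψ).symm)
      rw [this]
    intro h0
    have hx0 : x = 0 := by simpa [h0] using hle
    obtain ⟨ψ, hψ⟩ := exists_testFunction_expPairing_ne_zero ξ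
    exact hψ (by rw [← hx ψ, hx0]; simp)
  · push Not at h
    simp [rho, h]

/-- The weighted space `Ξ(ℝ, ρ)` of all (classes of) locally integrable `g` with `g ρ ∈ L^q(ℝ)`;
membership entails that `g` vanishes almost everywhere on `{ρ = ∞}`. -/
def weightedSpace (ι : UniformEmbedding X) (q : ℝ≥0∞) : Submodule ℂ (ℝ →ₘ[volume] ℂ) where
  carrier := {g | LocallyIntegrable g volume ∧ (∀ᵐ ξ, rho ι ξ = ∞ → g ξ = 0) ∧
    MemLp (fun ξ => g ξ * ((rho ι ξ).toReal : ℂ)) q volume}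
  add_mem' := by
    rintro f g ⟨hf1, hf2, hf3⟩ ⟨hg1, hg2, hg3⟩
    have hfg := AEEqFun.coeFn_add f g
    refine ⟨(hf1.add hg1).congr hfg.symm, ?_, (hf3.add hg3).ae_eq ?_⟩
    · filter_upwards [hfg, hf2, hg2] with ξ h h1 h2 hr
      simp [h, h1 hr, h2 hr]
    · filter_upwards [hfg] with ξ h
      simp [h, add_mul]
  zero_mem' := by
    have h0 : ((0 : ℝ →ₘ[volume] ℂ) : ℝ → ℂ) =ᵐ[volume] 0 := AEEqFun.coeFn_zero
    refine ⟨locallyIntegrable_zero.congr h0.symm, ?_, MemLp.zero.ae_eq (f := 0) ?_⟩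
    · filter_upwards [h0] with ξ h _
      simp [h]
    · filter_upwards [h0] with ξ h
      simp [h]
  smul_mem' := by
    rintro c g ⟨hg1, hg2, hg3⟩
    have hcg := AEEqFun.coeFn_smul c g
    refine ⟨(hg1.smul c).congr hcg.symm, ?_, (hg3.const_smul c).ae_eq ?_⟩
    · filter_upwards [hcg, hg2] with ξ h h1 hr
      simp [h, h1 hr]
    · filter_upwards [hcg] with ξ h
      simp [h, mul_assoc]

/-- Multiplication by the weight, `g ↦ g ρ`. -/
def weightMul (ι : UniformEmbedding X) (q : ℝ≥0∞) :
    weightedSpace ι q →ₗ[ℂ] Lp ℂ q (volume : Measure ℝ) where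
  toFun g := g.2.2.2.toLp _
  map_add' f g := by
    rw [← MemLp.toLp_add]
    refine MemLp.toLp_congr _ _ ?_
    filter_upwards [AEEqFun.coeFn_add (f : ℝ →ₘ[volume] ℂ) g] with ξ h
    simp [h, add_mul]
  map_smul' c g := by
    rw [RingHom.id_apply, ← MemLp.toLp_const_smul]
    refine MemLp.toLp_congr _ _ ?_
    filter_upwards [AEEqFun.coeFn_smul c (g : ℝ →ₘ[volume] ℂ)] with ξ h
    simp [h, mul_assoc]

theorem weightMul_injective (ι : UniformEmbedding X) (q : ℝ≥0∞) :
    Function.Injective (weightMul ι q) := by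
  rw [injective_iff_map_eq_zero]
  intro g hg
  have h1 := MemLp.coeFn_toLp g.2.2.2
  have h2 : (g.2.2.2.toLp _ : Lp ℂ q (volume : Measure ℝ)) = 0 := hg
  rw [h2] at h1
  refine Subtype.ext (AEEqFun.ext ?_)
  filter_upwards [h1, Lp.coeFn_zero ℂ q (volume : Measure ℝ), g.2.2.1,
    AEEqFun.coeFn_zero (α := ℝ) (β := ℂ) (μ := volume)] with ξ h3 h4 h5 h6
  rw [Submodule.coe_zero, h6, Pi.zero_apply]
  by_cases hr : rho ι ξ = ∞
  · exact h5 hr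
  · rw [h4, Pi.zero_apply] at h3
    have : (rho ι ξ).toReal ≠ 0 := ENNReal.toReal_ne_zero.2 ⟨rho_ne_zero ι ξ, hr⟩
    simpa [this] using h3.symm

/-- The norm `‖g‖ = ‖g ρ‖_q` on `Ξ(ℝ, ρ)`. -/
instance (ι : UniformEmbedding X) (q : ℝ≥0∞) [Fact (1 ≤ q)] :
    NormedAddCommGroup (weightedSpace ι q) :=
  NormedAddCommGroup.induced _ _ (weightMul ι q) (weightMul_injective ι q)

instance (ι : UniformEmbedding X) (q : ℝ≥0∞) [Fact (1 ≤ q)] :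
    NormedSpace ℂ (weightedSpace ι q) :=
  NormedSpace.induced ℂ _ _ (weightMul ι q)

/-- `û(ξ, y) = e^{-2πξy} g(ξ)`, that is, `g = û₀`. -/
def IsSymbol {ι : UniformEmbedding X} {q : ℝ≥0∞} [Fact (1 ≤ q)] (u : bergmanSpace ι q)
    (g : weightedSpace ι q) : Prop :=
  ∀ᵐ ξ, ∀ ψ : 𝓓(posHalfLine, ℝ),
    ι.toDist (transform ι q (u : MixedSpace ι q) ξ) ψ = (g : ℝ →ₘ[volume] ℂ) ξ * expPairing ξ ψ

/-- The condition `1/ρ ∈ L^∞_loc(ℝ)`. -/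
def InvRhoLocallyBounded (ι : UniformEmbedding X) : Prop :=
  ∀ K : Set ℝ, IsCompact K →
    MemLp (fun ξ => ((rho ι ξ)⁻¹).toReal) ∞ (volume.restrict K)

/-- The condition `e^{-2π⟨y₀,·⟩}/ρ ∈ L^∞(ℝ)`. -/
def ExpDivRhoBounded (ι : UniformEmbedding X) (y₀ : ℝ) : Prop :=
  MemLp (fun ξ => Real.exp (-(2 * Real.pi * ξ * y₀)) * ((rho ι ξ)⁻¹).toReal) ∞
    (volume : Measure ℝ)

/-- `supp û₀ ⊆ [0, ∞)` for all `u ∈ 𝓐^{q;X}`. -/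
def SupportProperty (ι : UniformEmbedding X) (q : ℝ≥0∞) [Fact (1 ≤ q)] : Prop :=
  ∀ (u : bergmanSpace ι q) (g : weightedSpace ι q), IsSymbol u g →
    ∀ᵐ ξ : ℝ, ξ < 0 → (g : ℝ →ₘ[volume] ℂ) ξ = 0

/-- `sup_{y > y₁} ‖u(·, y)‖_∞ < ∞` for all `u ∈ 𝓐^{q;X}`. -/
def BoundednessProperty (ι : UniformEmbedding X) (q : ℝ≥0∞) [Fact (1 ≤ q)] (y₁ : ℝ) : Prop :=
  ∀ (u : bergmanSpace ι q) (F : ℂ → ℂ), DifferentiableOn ℂ F upper →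
    IsFunction (u : MixedSpace ι q).toDistribution F →
    (⨆ y ∈ Ioi y₁, eLpNorm (fun x : ℝ => F (x + y * Complex.I)) ∞ volume) < ∞

/-- The measure `dν_λ(y) = (λ + 1)(2y)^λ dy` on `ℝ₊`. -/
def nu (lam : ℝ) : Measure ℝ :=
  (volume.restrict (Ioi 0)).withDensity fun y => ENNReal.ofReal ((lam + 1) * (2 * y) ^ lam)

end MixedFourier

end

/-! For `f` in `L^q(ℝ, X)` and a Schwartz function `φ`, the integral `∫ φ f` converges in `X` by
Hölder, and the uniform embedding sends `X` continuously into the distributions. So every `f`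
defines a distribution tempered in `x`, and the inverse Fourier transform gives the preimage of `f`
(`transform_surjective`). The isometry is built into the norm.

The core is the description of the holomorphic elements. In distributional form the Cauchy-Riemann
equation is `∂_y u = i ∂_x u`; the partial Fourier transform turns it into `∂_y û = -2πξ û`. For
almost every `ξ` the distribution `û(ξ)` thus solves a first-order linear equation on the half-line.
A test function orthogonal to `e^{-2πξy}` is of the form `θ' - 2πξθ`, so `û(ξ)` is a multiple `g(ξ)`
of that exponential (`exists_locallyIntegrable_symbol`). Since `û(ξ)` lies in `X`, `g(ξ) ≠ 0` forces
the exponential into `X`, and `‖û(ξ)‖ = |g(ξ)| ρ(ξ)`: this is the isometry.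

Conversely, `g` in `Ξ(ρ)` gives `f = (gρ) · (e^{-2πξ·}/ρ)`, which is in `L^q(ℝ, X)` once the second
factor is measurable. Pairing `f` with bumps at several heights bounds `g` so well that `∫ g(ξ)
e^{2πiξz} dξ` converges absolutely with exponential room to spare. It is therefore holomorphic, and
Fubini identifies it with `u`. If `g` vanishes on `ξ < 0`, the integral at heights above `y₁` is
dominated by the one at `y₁`.

Completeness of `Ξ(ρ)` holds because `g ↦ gρ` is an isometry onto a closed subspace of `L^q`. For `X
= L^p(ν_λ)`, `ρ` is a Gamma integral, and the exponentials depend on `ξ > 0` in a locally Lipschitz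
way. -/

noncomputable section

namespace MixedFourier

variable {X : Type*} [NormedAddCommGroup X] [NormedSpace ℂ X]

/-! ### The Fourier transform onto `L^q(ℝ, X)` -/

open scoped CompactConvergenceCLM

/-- The embedding of `X` into the distributions on the half-line is continuous. -/
def UniformEmbedding.toDistCLM (ι : UniformEmbedding X) : X →L[ℂ] 𝓓'(posHalfLine, ℂ) where
  toLinearMap := ι.toDist
  cont := by
    obtain ⟨p, hp, hb⟩ := ι.bound
    refine continuous_of_continuousAt_zero ι.toDist ?_
    rw [ContinuousAt, map_zero]
    refine (CompactConvergenceCLM.hasBasis_nhds_zero_of_basis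
      (Metric.nhds_basis_ball (x := (0 : ℂ)))).tendsto_right_iff.2 ?_
    rintro ⟨K, ε⟩ ⟨hK, hε⟩
    -- Distributions carry uniform convergence on compact sets of test functions, so a bound for `p`
    -- on the compact set `K` suffices.
    obtain ⟨C, hC⟩ := (hK.image hp).bddAbove
    have hev : ∀ᶠ x : X in 𝓝 0, ‖x‖ * (|C| + 1) < ε := by
      have : Tendsto (fun x : X => ‖x‖ * (|C| + 1)) (𝓝 0) (𝓝 0) := by
        have h : Continuous fun x : X => ‖x‖ * (|C| + 1) := by fun_prop
        simpa using h.tendsto 0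
      exact this.eventually_lt_const hε
    filter_upwards [hev] with x hx ψ hψ
    rw [mem_ball_zero_iff]
    refine ((hb x ψ).trans ?_).trans_lt hx
    have h1 : p ψ ≤ C := hC (mem_image_of_mem p hψ)
    have h2 : p ψ ≤ |C| + 1 := by linarith [le_abs_self C]
    gcongr

/-- The distribution given by an element of `L^q(ℝ, X)`. -/
def ofLp [CompleteSpace X] (ι : UniformEmbedding X) (q : ℝ≥0∞) [Fact (1 ≤ q)]
    (f : Lp X q (volume : Measure ℝ)) : SemiTempered :=
  haveI : ENNReal.HolderConjugate (ENNReal.conjExponent q) q :=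
    (ENNReal.HolderConjugate.conjExponent (Fact.out : 1 ≤ q)).symm
  haveI : Fact (1 ≤ ENNReal.conjExponent q) :=
    ⟨ENNReal.HolderConjugate.one_le (ENNReal.conjExponent q) q⟩
  ι.toDistCLM ∘L
    (((ContinuousLinearMap.lsmul ℂ ℂ (E := X)).lpPairing volume (ENNReal.conjExponent q) q).flip f) ∘L
    SchwartzMap.toLpCLM ℂ ℂ (ENNReal.conjExponent q) volume

/-- Evaluation at `ψ` is a continuous functional on `X`, so it passes under the Bochner integral `∫
φ f`. -/
theorem isGivenBy_ofLp [CompleteSpace X] (ι : UniformEmbedding X) (q : ℝ≥0∞) [Fact (1 ≤ q)]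
    (f : Lp X q (volume : Measure ℝ)) : IsGivenBy ι (ofLp ι q f) f := by
  intro φ ψ
  have : ENNReal.HolderConjugate (ENNReal.conjExponent q) q :=
    (ENNReal.HolderConjugate.conjExponent (Fact.out : 1 ≤ q)).symm
  have : Fact (1 ≤ ENNReal.conjExponent q) :=
    ⟨ENNReal.HolderConjugate.one_le (ENNReal.conjExponent q) q⟩
  have hint : Integrable (fun ξ => φ ξ • f ξ) :=
    memLp_one_iff_integrable.1 ((Lp.memLp f).smul (φ.memLp (ENNReal.conjExponent q)))
  have h1 : ((ContinuousLinearMap.lsmul ℂ ℂ (E := X)).lpPairing volume (ENNReal.conjExponent q) q)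
      (φ.toLp (ENNReal.conjExponent q)) f = ∫ ξ, φ ξ • f ξ := by
    rw [ContinuousLinearMap.lpPairing_eq_integral]
    refine integral_congr_ae ?_
    filter_upwards [φ.coeFn_toLp (ENNReal.conjExponent q) volume] with ξ h
    rw [h]
    rfl
  have h2 : ofLp ι q f φ ψ = ι.evalCLM ψ (∫ ξ, φ ξ • f ξ) := by
    rw [← h1]
    rfl
  rw [h2, ← (ι.evalCLM ψ).integral_comp_comm hint]
  simp

theorem transform_surjective [CompleteSpace X] (ι : UniformEmbedding X) (q : ℝ≥0∞)
    [Fact (1 ≤ q)] : Function.Surjective (transform ι q) := by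
  intro f
  let u : SemiTempered := ofLp ι q f ∘L FourierTransform.fourierInvCLM ℂ 𝓢(ℝ, ℂ)
  have hu : IsGivenBy ι (partialFourier u) f := by
    intro φ ψ
    rw [← isGivenBy_ofLp ι q f φ ψ]
    simp [partialFourier, u]
  let v : MixedSpace ι q := (⟨u, f, hu⟩ : mixedSubmodule ι q)
  exact ⟨v, (transform_spec ι q v).unique hu⟩

/-- The Fourier transform as an isometric isomorphism. -/
def transformEquiv [CompleteSpace X] (ι : UniformEmbedding X) (q : ℝ≥0∞) [Fact (1 ≤ q)] :
    MixedSpace ι q ≃ₗᵢ[ℂ] Lp X q (volume : Measure ℝ) where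
  toLinearEquiv := LinearEquiv.ofBijective (transform ι q)
    ⟨transform_injective ι q, transform_surjective ι q⟩
  norm_map' _ := rfl

/-! ### Completeness of the weighted space -/

theorem InvRhoLocallyBounded.aestronglyMeasurable {ι : UniformEmbedding X}
    (h : InvRhoLocallyBounded ι) :
    AEStronglyMeasurable (fun ξ => ((rho ι ξ)⁻¹).toReal) (volume : Measure ℝ) := by
  have h1 : ∀ n : ℕ, AEStronglyMeasurable (fun ξ => ((rho ι ξ)⁻¹).toReal)
      (volume.restrict (Metric.closedBall (0 : ℝ) n)) := fun n =>
    (h _ (isCompact_closedBall 0 _)).1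
  have h2 := aestronglyMeasurable_iUnion_iff.2 h1
  rwa [Metric.iUnion_closedBall_nat, Measure.restrict_univ] at h2

theorem norm_weightedSpace_def (ι : UniformEmbedding X) (q : ℝ≥0∞) [Fact (1 ≤ q)]
    (g : weightedSpace ι q) : ‖g‖ = ‖weightMul ι q g‖ := rfl

theorem weightMul_coeFn {ι : UniformEmbedding X} {q : ℝ≥0∞} (g : weightedSpace ι q) :
    weightMul ι q g =ᵐ[volume] fun ξ => (g : ℝ →ₘ[volume] ℂ) ξ * ((rho ι ξ).toReal : ℂ) :=
  MemLp.coeFn_toLp g.2.2.2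

/-- An `L^q`-convergent sequence has an almost everywhere convergent subsequence, which preserves
vanishing. -/
theorem isClosed_ae_eq_zero_of (q : ℝ≥0∞) [Fact (1 ≤ q)] (P : ℝ → Prop) :
    IsClosed {h : Lp ℂ q (volume : Measure ℝ) | ∀ᵐ ξ, P ξ → h ξ = 0} := by
  refine IsSeqClosed.isClosed fun h h₀ hn hlim => ?_
  obtain ⟨ns, -, hns⟩ := (tendstoInMeasure_of_tendsto_Lp hlim).exists_seq_tendsto_ae
  filter_upwards [hns, ae_all_iff.2 hn] with ξ h1 h2 hP
  have h3 : (fun i => h (ns i) ξ) = fun _ => 0 := funext fun i => h2 (ns i) hP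
  rw [h3] at h1
  exact (tendsto_nhds_unique h1 tendsto_const_nhds)

/-- The preimage of `h` is `h/ρ`; local boundedness of `1/ρ` makes it measurable and locally
integrable. Where `ρ = ∞` the convention `toReal ∞ = 0` agrees with the vanishing of `h`. -/
theorem range_weightMul {ι : UniformEmbedding X} (q : ℝ≥0∞) [Fact (1 ≤ q)]
    (hρ : InvRhoLocallyBounded ι) :
    range (weightMul ι q) = {h | ∀ᵐ ξ, rho ι ξ = ∞ → h ξ = 0} := by
  refine Subset.antisymm ?_ fun h hh => ?_
  · rintro _ ⟨g, rfl⟩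
    filter_upwards [weightMul_coeFn g] with ξ h1 h2
    simp [h1, h2]
  · have hmeas : AEStronglyMeasurable (fun ξ => h ξ * (((rho ι ξ)⁻¹).toReal : ℂ)) volume :=
      (Lp.aestronglyMeasurable h).mul
        (Complex.continuous_ofReal.comp_aestronglyMeasurable hρ.aestronglyMeasurable)
    have hg := AEEqFun.coeFn_mk _ hmeas
    have hmul : (fun ξ => AEEqFun.mk _ hmeas ξ * ((rho ι ξ).toReal : ℂ)) =ᵐ[volume] h := by
      filter_upwards [hg, hh] with ξ h1 h2
      rw [h1]
      by_cases hr : rho ι ξ = ∞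
      · simp [hr, h2 hr]
      · have h3 : (rho ι ξ).toReal ≠ 0 := ENNReal.toReal_ne_zero.2 ⟨rho_ne_zero ι ξ, hr⟩
        rw [ENNReal.toReal_inv, Complex.ofReal_inv, mul_assoc,
          inv_mul_cancel₀ (by exact_mod_cast h3), mul_one]
    have hloc : LocallyIntegrable (AEEqFun.mk _ hmeas) volume := by
      refine LocallyIntegrable.congr (locallyIntegrable_iff.2 fun K hK => ?_) hg.symm
      have h1 : MemLp h 1 (volume.restrict K) :=
        memLp_one_iff_integrable.2
          (locallyIntegrable_iff.1 ((Lp.memLp h).locallyIntegrable Fact.out) K hK)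
      exact memLp_one_iff_integrable.1 ((hρ K hK).ofReal.mul h1)
    refine ⟨⟨AEEqFun.mk _ hmeas, hloc, ?_, (Lp.memLp h).ae_eq hmul.symm⟩, ?_⟩
    · filter_upwards [hg] with ξ h1 h2
      rw [h1, h2]
      simp
    · exact Lp.ext ((weightMul_coeFn _).trans hmul)

theorem completeSpace_weightedSpace {ι : UniformEmbedding X} (q : ℝ≥0∞) [Fact (1 ≤ q)]
    (hρ : InvRhoLocallyBounded ι) : CompleteSpace (weightedSpace ι q) := by
  have hiso : Isometry (weightMul ι q) :=
    AddMonoidHomClass.isometry_of_norm (weightMul ι q) fun _ => rfl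
  rw [completeSpace_iff_isComplete_range hiso.isUniformInducing, range_weightMul q hρ]
  exact (isClosed_ae_eq_zero_of q _).isComplete

/-! ### Density of compactly supported functions in the Schwartz space -/

theorem exists_cutoff : ∃ χ : ℝ → ℂ, ContDiff ℝ (⊤ : ℕ∞) χ ∧ HasCompactSupport χ ∧
    ∀ x, |x| ≤ 1 → χ x = 1 := by
  let b : ContDiffBump (0 : ℝ) := ⟨1, 2, by norm_num, by norm_num⟩
  refine ⟨fun x => (b x : ℂ), Complex.ofRealCLM.contDiff.comp b.contDiff,
    b.hasCompactSupport.comp_left (g := fun t : ℝ => (t : ℂ)) Complex.ofReal_zero, fun x hx => ?_⟩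
  have : b x = 1 := b.one_of_mem_closedBall (by simpa using hx)
  simp [this]

/-- Dilation by `a` multiplies the `i`-th derivative by `a ^ i`, so for `|a| ≤ 1` one bound serves
all dilates. -/
theorem exists_bound_iteratedFDeriv_one_sub {χ : ℝ → ℂ} (hχ : ContDiff ℝ (⊤ : ℕ∞) χ)
    (hχc : HasCompactSupport χ) (m : ℕ) :
    ∃ C, 0 ≤ C ∧ ∀ (x : ℝ) (a : ℝ), |a| ≤ 1 → ∀ i ≤ m,
      ‖iteratedFDeriv ℝ i (fun y => 1 - χ (a * y)) x‖ ≤ C := by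
  have h1 : ∀ i : ℕ, ∃ C, ∀ x, ‖iteratedFDeriv ℝ i χ x‖ ≤ C := fun i =>
    (hχc.iteratedFDeriv i).exists_bound_of_continuous
      (hχ.continuous_iteratedFDeriv (by exact_mod_cast le_top))
  choose C hC using h1
  have hC0 : ∀ i, 0 ≤ C i := fun i => (norm_nonneg _).trans (hC i 0)
  refine ⟨1 + ∑ i ∈ Finset.range (m + 1), C i,
    add_nonneg zero_le_one (Finset.sum_nonneg fun i _ => hC0 i), fun x a ha i hi => ?_⟩
  have hχi : ContDiff ℝ i χ := hχ.of_le (by exact_mod_cast le_top)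
  have hχa : ContDiff ℝ i (fun y => χ (a * y)) := hχi.comp (by fun_prop)
  have hs : iteratedFDeriv ℝ i (fun y => χ (a * y)) x = a ^ i • iteratedFDeriv ℝ i χ (a * x) :=
    congrFun (iteratedFDeriv_comp_const_smul a hχi) x
  have hsub : iteratedFDeriv ℝ i (fun y => 1 - χ (a * y)) x =
      iteratedFDeriv ℝ i (fun _ => (1 : ℂ)) x - iteratedFDeriv ℝ i (fun y => χ (a * y)) x :=
    iteratedFDeriv_sub_apply contDiffAt_const hχa.contDiffAt
  rw [hsub]
  refine (norm_sub_le _ _).trans (add_le_add ?_ ?_)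
  · rcases Nat.eq_zero_or_pos i with rfl | hi0
    · simp
    · rw [iteratedFDeriv_const_of_ne hi0.ne']
      simp
  · rw [hs, norm_smul, norm_pow, Real.norm_eq_abs]
    refine (mul_le_of_le_one_left (norm_nonneg _) (pow_le_one₀ (abs_nonneg a) ha)).trans ?_
    exact (hC i _).trans (Finset.single_le_sum (f := C) (fun i _ => hC0 i)
      (Finset.mem_range.2 (by omega)))

/-- The difference `φ - θ` vanishes for `|x| < n + 1`. For larger `|x|` an extra power of `|x|` is
at least `n + 1`, which gains the factor `1 / (n + 1)` at the cost of seminorms with `k + 1` in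
place of `k`. -/
theorem seminorm_sub_cutoff_le {χ : ℝ → ℂ} (hχ : ContDiff ℝ (⊤ : ℕ∞) χ)
    (hχc : HasCompactSupport χ) (hχ1 : ∀ x, |x| ≤ 1 → χ x = 1) (φ : 𝓢(ℝ, ℂ)) (k m : ℕ) :
    ∃ C, ∀ (n : ℕ) (θ : 𝓢(ℝ, ℂ)), (∀ x, θ x = χ ((n + 1 : ℝ)⁻¹ * x) * φ x) →
      SchwartzMap.seminorm ℂ k m (φ - θ) ≤ C / (n + 1) := by
  obtain ⟨C, hC0, hC⟩ := exists_bound_iteratedFDeriv_one_sub hχ hχc m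
  let D : ℝ := ∑ i ∈ Finset.range (m + 1),
    (m.choose i : ℝ) * C * SchwartzMap.seminorm ℂ (k + 1) (m - i) φ
  have hD0 : 0 ≤ D := Finset.sum_nonneg fun i _ => by positivity
  refine ⟨D, fun n θ hθ => SchwartzMap.seminorm_le_bound ℂ k m _ (by positivity) fun x => ?_⟩
  set a : ℝ := (n + 1 : ℝ)⁻¹ with ha
  have hn : (0 : ℝ) < n + 1 := by positivity
  have ha0 : 0 < a := by positivity
  have ha1 : |a| ≤ 1 := by
    rw [abs_of_pos ha0]
    exact inv_le_one_of_one_le₀ (by linarith [n.cast_nonneg (α := ℝ)])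
  have hfun : ((φ - θ : 𝓢(ℝ, ℂ)) : ℝ → ℂ) = fun y => (1 - χ (a * y)) * φ y := by
    funext y
    have : (φ - θ) y = φ y - θ y := rfl
    rw [this, hθ]
    ring
  rw [hfun]
  by_cases hx : |x| < n + 1
  · have hzero : (fun y => (1 - χ (a * y)) * φ y) =ᶠ[𝓝 x] fun _ => 0 := by
      filter_upwards [(isOpen_Iio.preimage continuous_abs).mem_nhds hx] with y hy
      have hy' : |y| < n + 1 := hy
      have : |a * y| ≤ 1 := by
        rw [abs_mul, abs_of_pos ha0, ha, inv_mul_le_iff₀ hn, mul_one]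
        exact hy'.le
      rw [hχ1 _ this]
      ring
    rw [(hzero.iteratedFDeriv ℝ m).eq_of_nhds]
    simp only [iteratedFDeriv_fun_zero, Pi.zero_apply, norm_zero, mul_zero]
    positivity
  · push Not at hx
    have hL := norm_iteratedFDeriv_mul_le (𝕜 := ℝ) (N := m) (f := fun y => 1 - χ (a * y)) (g := φ)
      (contDiff_const.sub ((hχ.of_le (by exact_mod_cast le_top)).comp (by fun_prop)))
      (φ.smooth m) x le_rfl
    calc ‖x‖ ^ k * ‖iteratedFDeriv ℝ m (fun y => (1 - χ (a * y)) * φ y) x‖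
        ≤ ‖x‖ ^ k * ∑ i ∈ Finset.range (m + 1), (m.choose i : ℝ) *
          ‖iteratedFDeriv ℝ i (fun y => 1 - χ (a * y)) x‖ * ‖iteratedFDeriv ℝ (m - i) φ x‖ := by
          gcongr
      _ = ∑ i ∈ Finset.range (m + 1), (m.choose i : ℝ) *
          ‖iteratedFDeriv ℝ i (fun y => 1 - χ (a * y)) x‖ *
            (‖x‖ ^ k * ‖iteratedFDeriv ℝ (m - i) φ x‖) := by
          rw [Finset.mul_sum]
          exact Finset.sum_congr rfl fun i _ => by ring
      _ ≤ ∑ i ∈ Finset.range (m + 1), (m.choose i : ℝ) * C *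
            (SchwartzMap.seminorm ℂ (k + 1) (m - i) φ / (n + 1)) := by
          refine Finset.sum_le_sum fun i hi => ?_
          have h1 := hC x a ha1 i (by simpa [Nat.lt_succ_iff] using hi)
          have h2 : ‖x‖ ^ k * ‖iteratedFDeriv ℝ (m - i) φ x‖ ≤
              SchwartzMap.seminorm ℂ (k + 1) (m - i) φ / (n + 1) := by
            rw [le_div_iff₀ hn]
            refine le_trans ?_ (SchwartzMap.le_seminorm ℂ (k + 1) (m - i) φ x)
            rw [pow_succ, mul_right_comm, mul_assoc, mul_assoc]
            gcongr
            simpa using hx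
          gcongr
      _ = D / (n + 1) := by
          rw [Finset.sum_div]
          exact Finset.sum_congr rfl fun i _ => by ring

/-- Compactly supported functions are dense in the Schwartz space of the line. -/
theorem dense_hasCompactSupport_schwartz : Dense {φ : 𝓢(ℝ, ℂ) | HasCompactSupport φ} := by
  obtain ⟨χ, hχ, hχc, hχ1⟩ := exists_cutoff
  intro φ
  have hcs : ∀ n : ℕ, HasCompactSupport fun x => χ ((n + 1 : ℝ)⁻¹ * x) * φ x := fun n =>
    (hχc.comp_homeomorph (Homeomorph.mulLeft₀ ((n + 1 : ℝ)⁻¹) (by positivity))).mul_right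
  have hsm : ∀ n : ℕ, ContDiff ℝ (⊤ : ℕ∞) fun x => χ ((n + 1 : ℝ)⁻¹ * x) * φ x := fun n =>
    (hχ.comp (by fun_prop)).mul (φ.smooth ⊤)
  let θ : ℕ → 𝓢(ℝ, ℂ) := fun n => (hcs n).toSchwartzMap (hsm n)
  have hθ : ∀ n x, θ n x = χ ((n + 1 : ℝ)⁻¹ * x) * φ x := fun n x => rfl
  refine mem_closure_of_tendsto (f := θ) (b := atTop) ?_ (Eventually.of_forall hcs)
  rw [(schwartz_withSeminorms ℂ ℝ ℂ).tendsto_nhds θ φ]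
  rintro ⟨k, m⟩ ε hε
  obtain ⟨C, hC⟩ := seminorm_sub_cutoff_le hχ hχc hχ1 φ k m
  have h1 : Tendsto (fun n : ℕ => C / ((n : ℝ) + 1)) atTop (𝓝 0) := by
    simpa [Function.comp_def] using
      (tendsto_const_div_atTop_nhds_zero_nat C).comp (tendsto_add_atTop_nat 1)
  filter_upwards [h1.eventually_lt_const hε] with n hn
  have h2 := hC n (θ n) (hθ n)
  rw [SchwartzMap.schwartzSeminormFamily_apply, map_sub_rev]
  exact h2.trans_lt hn

/-! ### The Cauchy-Riemann equation and its Fourier transform -/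

theorem isOpen_upper : IsOpen upper := isOpen_lt continuous_const Complex.continuous_im

theorem mem_upper {x y : ℝ} (hy : 0 < y) : (x + y * Complex.I : ℂ) ∈ upper := by
  simpa [upper] using hy

/-- The derivative of a test function on the half-line. -/
def derivTest (ψ : 𝓓(posHalfLine, ℝ)) : 𝓓(posHalfLine, ℝ) :=
  ⟨deriv ψ, (contDiff_infty_iff_deriv.1 ψ.contDiff).2, ψ.hasCompactSupport.deriv,
    (closure_minimal support_deriv_subset (isClosed_tsupport _)).trans ψ.tsupport_subset⟩

theorem derivTest_apply (ψ : 𝓓(posHalfLine, ℝ)) (y : ℝ) : derivTest ψ y = deriv ψ y := rfl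

theorem hasDerivAt_testFunction (ψ : 𝓓(posHalfLine, ℝ)) (y : ℝ) :
    HasDerivAt ψ (derivTest ψ y) y :=
  ((contDiff_infty_iff_deriv.1 ψ.contDiff).1 y).hasDerivAt

theorem testFunction_eq_zero_of_nonpos (ψ : 𝓓(posHalfLine, ℝ)) {y : ℝ} (hy : y ≤ 0) : ψ y = 0 :=
  image_eq_zero_of_notMem_tsupport fun h =>
    (not_lt.2 hy) (ψ.tsupport_subset h : y ∈ Ioi (0 : ℝ))

theorem pos_of_mem_tsupport (ψ : 𝓓(posHalfLine, ℝ)) {y : ℝ} (hy : y ∈ tsupport ψ) : 0 < y :=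
  ψ.tsupport_subset hy

theorem integrable_of_continuousOn_isCompact {E F : Type*} [TopologicalSpace E] [T2Space E]
    [MeasureSpace E] [OpensMeasurableSpace E] [IsFiniteMeasureOnCompacts (volume : Measure E)]
    [NormedAddCommGroup F] [SecondCountableTopologyEither E F] {f : E → F} {K : Set E}
    (hK : IsCompact K) (hc : ContinuousOn f K) (hs : Function.support f ⊆ K) : Integrable f :=
  (integrableOn_iff_integrable_of_support_subset hs).1
    (hc.integrableOn_compact' hK hK.measurableSet)

section Product

variable {F : ℂ → ℂ} {φ : ℝ → ℂ} {ψ : ℝ → ℝ} {A B : Set ℝ}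

theorem continuousOn_product (hF : ContinuousOn F upper) (hφ : Continuous φ) (hψ : Continuous ψ)
    (hB : B ⊆ Ioi 0) : ContinuousOn
      (fun z : ℝ × ℝ => F (z.1 + z.2 * Complex.I) * (φ z.1 * (ψ z.2 : ℂ))) (A ×ˢ B) := by
  refine ContinuousOn.mul (hF.comp (by fun_prop) fun z hz => mem_upper (hB hz.2)) ?_
  fun_prop

theorem integrable_product (hF : ContinuousOn F upper) (hφ : Continuous φ) (hψ : Continuous ψ)
    (hA : IsCompact A) (hB : IsCompact B) (hB0 : B ⊆ Ioi 0) (hφA : Function.support φ ⊆ A)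
    (hψB : Function.support ψ ⊆ B) :
    Integrable (fun z : ℝ × ℝ => F (z.1 + z.2 * Complex.I) * (φ z.1 * (ψ z.2 : ℂ))) := by
  refine integrable_of_continuousOn_isCompact (hA.prod hB) (continuousOn_product hF hφ hψ hB0) ?_
  intro z hz
  simp only [Function.mem_support, ne_eq, mul_eq_zero, not_or, Complex.ofReal_eq_zero] at hz
  exact ⟨hφA hz.2.1, hψB hz.2.2⟩

theorem setIntegral_product (hψB : Function.support ψ ⊆ Ioi 0) :
    ∫ z in {z : ℝ × ℝ | 0 < z.2}, F (z.1 + z.2 * Complex.I) * (φ z.1 * (ψ z.2 : ℂ)) =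
      ∫ z : ℝ × ℝ, F (z.1 + z.2 * Complex.I) * (φ z.1 * (ψ z.2 : ℂ)) := by
  refine setIntegral_eq_integral_of_forall_compl_eq_zero fun z hz => ?_
  have : ψ z.2 = 0 := by
    by_contra h
    exact hz (hψB h)
  simp [this]

/-- Integration by parts on a vertical line. `F` is controlled only above the real axis, but its
derivative is needed only on the support of `ψ`; the factor `i` is the direction of the line. -/
theorem integral_product_deriv_right (hF : DifferentiableOn ℂ F upper) {ψ' : ℝ → ℝ}
    (hψ : ∀ y, HasDerivAt ψ (ψ' y) y) (hψ' : Continuous ψ') (hB : IsCompact (tsupport ψ))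
    (hB0 : tsupport ψ ⊆ Ioi 0) (x : ℝ) (c : ℂ) :
    ∫ y : ℝ, F (x + y * Complex.I) * (c * (ψ' y : ℂ)) =
      -∫ y : ℝ, Complex.I * (deriv F (x + y * Complex.I) * (c * (ψ y : ℂ))) := by
  have hψc : Continuous ψ := continuous_iff_continuousAt.2 fun y => (hψ y).continuousAt
  have hline : ∀ y : ℝ, HasDerivAt (fun y : ℝ => (x + y * Complex.I : ℂ)) Complex.I y := fun y => by
    simpa using ((hasDerivAt_id y).ofReal_comp.mul_const Complex.I).const_add (x : ℂ)
  have hψ's : Function.support ψ' ⊆ tsupport ψ := by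
    have : ψ' = deriv ψ := funext fun y => (hψ y).deriv.symm
    rw [this]
    exact support_deriv_subset
  have hts : tsupport (fun y => (ψ y : ℂ)) ⊆ tsupport ψ :=
    tsupport_comp_subset Complex.ofReal_zero ψ
  have hcont : ∀ {G : ℂ → ℂ} {χ : ℝ → ℝ}, ContinuousOn G upper → Continuous χ →
      Function.support χ ⊆ tsupport ψ →
      Integrable (fun y : ℝ => G (x + y * Complex.I) * (χ y : ℂ)) := by
    intro G χ hG hχ hs
    refine integrable_of_continuousOn_isCompact hB ?_ ?_
    · exact (hG.comp (by fun_prop) fun y hy => mem_upper (hB0 hy)).mul (by fun_prop)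
    · intro y hy
      simp only [Function.mem_support, ne_eq, mul_eq_zero, not_or, Complex.ofReal_eq_zero] at hy
      exact hs hy.2
  have h := integral_mul_deriv_eq_deriv_mul_of_integrable
    (u := fun y : ℝ => F (x + y * Complex.I)) (v := fun y => (ψ y : ℂ))
    (u' := fun y : ℝ => deriv F (x + y * Complex.I) * Complex.I) (v' := fun y => (ψ' y : ℂ))
    (fun y hy => ((hF.differentiableAt (isOpen_upper.mem_nhds
      (mem_upper (hB0 (hts hy))))).hasDerivAt.comp y (hline y)))
    (fun y _ => (hψ y).ofReal_comp) (hcont hF.continuousOn hψ' hψ's)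
    (hcont (G := fun z => deriv F z * Complex.I)
      ((hF.deriv isOpen_upper).continuousOn.mul continuousOn_const) hψc (subset_tsupport ψ))
    (hcont hF.continuousOn hψc (subset_tsupport ψ))
  have h1 : ∀ y : ℝ, F (x + y * Complex.I) * (c * (ψ' y : ℂ)) =
      c * (F (x + y * Complex.I) * (ψ' y : ℂ)) := fun y => by ring
  have h2 : ∀ y : ℝ, Complex.I * (deriv F (x + y * Complex.I) * (c * (ψ y : ℂ))) =
      c * (deriv F (x + y * Complex.I) * Complex.I * (ψ y : ℂ)) := fun y => by ring
  simp only [h1, h2, integral_const_mul]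
  rw [h, mul_neg]

theorem integral_product_deriv_left (hF : DifferentiableOn ℂ F upper) {φ' : ℝ → ℂ}
    (hφ : ∀ x, HasDerivAt φ (φ' x) x) (hφ' : Continuous φ') (hA : IsCompact (tsupport φ))
    {y : ℝ} (hy : 0 < y) (c : ℂ) :
    ∫ x : ℝ, F (x + y * Complex.I) * (φ' x * c) =
      -∫ x : ℝ, deriv F (x + y * Complex.I) * (φ x * c) := by
  have hφc : Continuous φ := continuous_iff_continuousAt.2 fun y => (hφ y).continuousAt
  have hline : ∀ x : ℝ, HasDerivAt (fun x : ℝ => (x + y * Complex.I : ℂ)) 1 x := fun x => by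
    simpa using (hasDerivAt_id x).ofReal_comp.add_const (y * Complex.I : ℂ)
  have hφ's : Function.support φ' ⊆ tsupport φ := by
    have : φ' = deriv φ := funext fun y => (hφ y).deriv.symm
    rw [this]
    exact support_deriv_subset
  have hcont : ∀ {G : ℂ → ℂ} {χ : ℝ → ℂ}, ContinuousOn G upper → Continuous χ →
      Function.support χ ⊆ tsupport φ →
      Integrable (fun x : ℝ => G (x + y * Complex.I) * χ x) := by
    intro G χ hG hχ hs
    refine integrable_of_continuousOn_isCompact hA ?_ ?_
    · exact (hG.comp (by fun_prop) fun x _ => mem_upper hy).mul (by fun_prop)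
    · intro x hx
      simp only [Function.mem_support, ne_eq, mul_eq_zero, not_or] at hx
      exact hs hx.2
  have h := integral_mul_deriv_eq_deriv_mul_of_integrable
    (u := fun x : ℝ => F (x + y * Complex.I)) (v := φ)
    (u' := fun x : ℝ => deriv F (x + y * Complex.I) * 1) (v' := φ')
    (fun x _ => ((hF.differentiableAt (isOpen_upper.mem_nhds
      (mem_upper hy))).hasDerivAt.comp x (hline x)))
    (fun x _ => hφ x) (hcont hF.continuousOn hφ' hφ's)
    (hcont (G := fun z => deriv F z * 1)
      ((hF.deriv isOpen_upper).continuousOn.mul continuousOn_const) hφc (subset_tsupport φ))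
    (hcont hF.continuousOn hφc (subset_tsupport φ))
  simp only [← mul_assoc, integral_mul_const]
  rw [h]
  simp

end Product

/-- The Cauchy-Riemann equation `∂_y u = i ∂_x u` for a holomorphic function, tested against
products of test functions. -/
theorem IsFunction.cauchyRiemann {u : SemiTempered} {F : ℂ → ℂ} (hF : DifferentiableOn ℂ F upper)
    (hu : IsFunction u F) {φ : 𝓢(ℝ, ℂ)} (hφ : HasCompactSupport φ) (ψ : 𝓓(posHalfLine, ℝ)) :
    u φ (derivTest ψ) = Complex.I * u (SchwartzMap.derivCLM ℂ ℂ φ) ψ := by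
  have hφ' : HasCompactSupport (SchwartzMap.derivCLM ℂ ℂ φ) :=
    hφ.of_isClosed_subset (isClosed_tsupport _) (SchwartzMap.tsupport_derivCLM_subset ℂ φ)
  have hsub : ∀ χ : 𝓓(posHalfLine, ℝ), Function.support χ ⊆ Ioi 0 := fun χ =>
    (subset_tsupport χ).trans χ.tsupport_subset
  have hint : ∀ {G : ℂ → ℂ} {θ : 𝓢(ℝ, ℂ)} (χ : 𝓓(posHalfLine, ℝ)), ContinuousOn G upper →
      HasCompactSupport θ →
      Integrable (fun z : ℝ × ℝ => G (z.1 + z.2 * Complex.I) * (θ z.1 * (χ z.2 : ℂ))) :=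
    fun {G θ} χ hG hθ => integrable_product hG θ.continuous χ.continuous hθ χ.hasCompactSupport
      χ.tsupport_subset (subset_tsupport _) (subset_tsupport _)
  have hF' := (hF.deriv isOpen_upper).continuousOn
  rw [hu φ hφ, hu _ hφ', setIntegral_product (hsub _), setIntegral_product (hsub _)]
  have h1 : ∫ z : ℝ × ℝ, F (z.1 + z.2 * Complex.I) * (φ z.1 * (derivTest ψ z.2 : ℂ)) =
      -(Complex.I * ∫ z : ℝ × ℝ, deriv F (z.1 + z.2 * Complex.I) * (φ z.1 * (ψ z.2 : ℂ))) := by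
    -- The inner integral runs over the variable being differentiated: `y` here, `x` in the next
    -- identity.
    rw [Measure.volume_eq_prod, integral_prod _ (hint _ hF.continuousOn hφ),
      integral_prod _ (hint _ hF' hφ), ← integral_const_mul, ← integral_neg]
    refine integral_congr_ae (ae_of_all _ fun x => ?_)
    simp only
    rw [integral_product_deriv_right hF (hasDerivAt_testFunction ψ) (derivTest ψ).continuous
      ψ.hasCompactSupport ψ.tsupport_subset, integral_const_mul]
  have h2 : ∫ z : ℝ × ℝ, F (z.1 + z.2 * Complex.I) *
      (SchwartzMap.derivCLM ℂ ℂ φ z.1 * (ψ z.2 : ℂ)) =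
      -∫ z : ℝ × ℝ, deriv F (z.1 + z.2 * Complex.I) * (φ z.1 * (ψ z.2 : ℂ)) := by
    rw [Measure.volume_eq_prod, integral_prod_symm _ (hint _ hF.continuousOn hφ'),
      integral_prod_symm _ (hint _ hF' hφ), ← integral_neg]
    refine integral_congr_ae (ae_of_all _ fun y => ?_)
    simp only
    rcases le_or_gt y 0 with hy | hy
    · simp [testFunction_eq_zero_of_nonpos ψ hy]
    · exact integral_product_deriv_left hF (fun x => φ.hasDerivAt x)
        (SchwartzMap.derivCLM ℂ ℂ φ).continuous hφ hy _
  rw [h1, h2, mul_neg]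

/-- The Cauchy-Riemann equation tested against all Schwartz functions in `x`. -/
theorem IsFunction.cauchyRiemann_schwartz {u : SemiTempered} {F : ℂ → ℂ}
    (hF : DifferentiableOn ℂ F upper) (hu : IsFunction u F) (φ : 𝓢(ℝ, ℂ))
    (ψ : 𝓓(posHalfLine, ℝ)) :
    u φ (derivTest ψ) = Complex.I * u (SchwartzMap.derivCLM ℂ ℂ φ) ψ := by
  have hev : ∀ χ : 𝓓(posHalfLine, ℝ), Continuous fun φ : 𝓢(ℝ, ℂ) => u φ χ := fun χ =>
    (continuous_eval_const χ).comp u.continuous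
  have hcl : IsClosed {φ : 𝓢(ℝ, ℂ) | u φ (derivTest ψ) =
      Complex.I * u (SchwartzMap.derivCLM ℂ ℂ φ) ψ} :=
    isClosed_eq (hev _) (continuous_const.mul
      ((hev ψ).comp (SchwartzMap.derivCLM ℂ ℂ).continuous))
  -- `IsFunction` tests only compactly supported `φ`. The equation is needed for Fourier transforms
  -- `φ = η̂`, and density and continuity provide it.
  have hsub := closure_minimal (s := {φ : 𝓢(ℝ, ℂ) | HasCompactSupport φ})
    (fun φ hφ => hu.cauchyRiemann hF hφ ψ) hcl
  rw [dense_hasCompactSupport_schwartz.closure_eq] at hsub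
  exact hsub (mem_univ φ)

theorem deriv_fourier_schwartz (η : 𝓢(ℝ, ℂ)) :
    SchwartzMap.derivCLM ℂ ℂ (𝓕 η) =
      𝓕 (-(2 * Real.pi * Complex.I) • SchwartzMap.smulLeftCLM ℂ (fun x : ℝ => inner ℝ x 1) η) := by
  rw [← SchwartzMap.lineDerivOp_fourier_eq]
  ext x
  rw [SchwartzMap.derivCLM_apply, SchwartzMap.lineDerivOp_apply_eq_fderiv,
    fderiv_apply_one_eq_deriv]

theorem smulLeftCLM_inner_one_apply (η : 𝓢(ℝ, ℂ)) (ξ : ℝ) :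
    SchwartzMap.smulLeftCLM ℂ (fun x : ℝ => inner ℝ x 1) η ξ = ξ * η ξ := by
  rw [SchwartzMap.smulLeftCLM_apply_apply (by fun_prop)]
  simp

/-- Differentiating `η̂` amounts to multiplying `η` by `-2πiξ`, and `i · (-2πi) = 2π`. After moving
the derivative off `ψ` this reads `∂_y û = -2πξ û`. -/
theorem partialFourier_cauchyRiemann {u : SemiTempered} {F : ℂ → ℂ}
    (hF : DifferentiableOn ℂ F upper) (hu : IsFunction u F) (η : 𝓢(ℝ, ℂ))
    (ψ : 𝓓(posHalfLine, ℝ)) :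
    partialFourier u η (derivTest ψ) = 2 * Real.pi *
      partialFourier u (SchwartzMap.smulLeftCLM ℂ (fun x : ℝ => inner ℝ x 1) η) ψ := by
  have h := hu.cauchyRiemann_schwartz hF (𝓕 η) ψ
  rw [deriv_fourier_schwartz, FourierTransform.fourier_smul, map_smul] at h
  have h2 : ∀ θ : 𝓢(ℝ, ℂ), partialFourier u θ = u (𝓕 θ) := fun θ => rfl
  rw [h2, h2, h]
  generalize u (𝓕 (SchwartzMap.smulLeftCLM ℂ (fun x : ℝ => inner ℝ x 1) η)) = T
  have h3 : (-(2 * Real.pi * Complex.I) • T) ψ = -(2 * Real.pi * Complex.I) * T ψ := rfl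
  rw [h3]
  linear_combination (-2 * Real.pi * T ψ) * Complex.I_mul_I

/-! ### The differential equation at almost every frequency -/

theorem locallyIntegrable_pairing (ι : UniformEmbedding X) {q : ℝ≥0∞} [Fact (1 ≤ q)]
    (f : Lp X q (volume : Measure ℝ)) (ψ : 𝓓(posHalfLine, ℝ)) :
    LocallyIntegrable (fun ξ => ι.toDist (f ξ) ψ) volume :=
  ((ι.evalCLM ψ).comp_memLp f).locallyIntegrable Fact.out

/-- Testing in `ξ` against all smooth compactly supported functions localises the equation; the
exceptional null set still depends on `ψ`. -/
theorem IsGivenBy.ae_deriv {ι : UniformEmbedding X} {q : ℝ≥0∞} [Fact (1 ≤ q)] {u : SemiTempered}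
    {f : Lp X q (volume : Measure ℝ)} (hf : IsGivenBy ι (partialFourier u) f) {F : ℂ → ℂ}
    (hF : DifferentiableOn ℂ F upper) (hu : IsFunction u F) (ψ : 𝓓(posHalfLine, ℝ)) :
    ∀ᵐ ξ : ℝ, ι.toDist (f ξ) (derivTest ψ) - 2 * Real.pi * ξ * ι.toDist (f ξ) ψ = 0 := by
  have hL1 := locallyIntegrable_pairing ι f ψ
  have hL : LocallyIntegrable (fun ξ : ℝ => ι.toDist (f ξ) (derivTest ψ) -
      (2 * Real.pi * ξ : ℂ) * ι.toDist (f ξ) ψ) volume := by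
    refine (locallyIntegrable_pairing ι f (derivTest ψ)).sub ?_
    rw [← locallyIntegrableOn_univ] at hL1 ⊢
    refine hL1.continuousOn_mul ?_ isOpen_univ.isLocallyClosed
    fun_prop
  refine ae_eq_zero_of_integral_contDiff_smul_eq_zero hL fun g hg hgs => ?_
  have hgc : HasCompactSupport (fun x => (g x : ℂ)) :=
    hgs.comp_left (g := fun t : ℝ => (t : ℂ)) Complex.ofReal_zero
  have hgd : ContDiff ℝ (⊤ : ℕ∞) (fun x => (g x : ℂ)) := Complex.ofRealCLM.contDiff.comp hg
  let η : 𝓢(ℝ, ℂ) := hgc.toSchwartzMap hgd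
  have hη : ∀ ξ, (η ξ : ℂ) = g ξ := fun ξ => rfl
  have h := partialFourier_cauchyRiemann hF hu η ψ
  rw [hf, hf, ← integral_const_mul, ← sub_eq_zero,
    ← integral_sub (integrable_pairing ι f η _) ((integrable_pairing ι f _ ψ).const_mul _)] at h
  rw [← h]
  refine integral_congr_ae (ae_of_all _ fun ξ => ?_)
  simp only [smulLeftCLM_inner_one_apply, hη, Complex.real_smul]
  ring

/-- For almost every `ξ`, the differential equation holds against all test functions. -/
theorem IsGivenBy.ae_forall_deriv {ι : UniformEmbedding X} {q : ℝ≥0∞} [Fact (1 ≤ q)]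
    {u : SemiTempered} {f : Lp X q (volume : Measure ℝ)}
    (hf : IsGivenBy ι (partialFourier u) f) {F : ℂ → ℂ} (hF : DifferentiableOn ℂ F upper)
    (hu : IsFunction u F) :
    ∀ᵐ ξ : ℝ, ∀ ψ, ι.toDist (f ξ) (derivTest ψ) - 2 * Real.pi * ξ * ι.toDist (f ξ) ψ = 0 := by
  obtain ⟨t, ht, hft⟩ := (Lp.aestronglyMeasurable f).isSeparable_ae_range
  have : SeparableSpace (closure t) := ht.closure.separableSpace
  have : SecondCountableTopology (closure t) := UniformSpace.secondCountable_of_separable _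
  -- One null set must serve all `ψ`. Since `f` has essentially separable range, the points `(ξ, f
  -- ξ)` lie in a second countable space, and the Lindelöf property reduces the open sets where the
  -- equation fails to countably many.
  let U : 𝓓(posHalfLine, ℝ) → Set (ℝ × closure t) := fun ψ =>
    {x | ι.evalCLM (derivTest ψ) x.2 - 2 * Real.pi * x.1 * ι.evalCLM ψ x.2 ≠ 0}
  have hU : ∀ ψ, IsOpen (U ψ) := fun ψ => by
    refine isOpen_ne_fun ?_ continuous_const
    have h1 := (ι.evalCLM ψ).continuous
    have h2 := (ι.evalCLM (derivTest ψ)).continuous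
    fun_prop
  obtain ⟨T, hT, hTU⟩ := isOpen_iUnion_countable U hU
  have hall := (ae_ball_iff hT).2 fun ψ _ => hf.ae_deriv hF hu ψ
  filter_upwards [hall, hft] with ξ h1 h2 ψ
  by_contra hne
  have hmem : (ξ, (⟨f ξ, subset_closure h2⟩ : closure t)) ∈ ⋃ ψ, U ψ := mem_iUnion.2 ⟨ψ, hne⟩
  rw [← hTU] at hmem
  simp only [mem_iUnion] at hmem
  obtain ⟨ψ', hT', hne'⟩ := hmem
  exact hne' (h1 ψ' hT')

/-! ### Pairings of test functions with exponentials -/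

theorem exists_tsupport_subset_Icc (ψ : 𝓓(posHalfLine, ℝ)) :
    ∃ a b : ℝ, 0 < a ∧ a ≤ b ∧ tsupport ψ ⊆ Icc a b := by
  rcases (tsupport ψ).eq_empty_or_nonempty with h | h
  · exact ⟨1, 1, one_pos, le_rfl, by simp [h]⟩
  · have hc : IsCompact (tsupport ψ) := ψ.hasCompactSupport
    obtain ⟨a, ha⟩ := hc.exists_isLeast h
    obtain ⟨b, hb⟩ := hc.exists_isGreatest h
    exact ⟨a, b, pos_of_mem_tsupport ψ ha.1, ha.2 hb.1, fun y hy => ⟨ha.2 hy, hb.2 hy⟩⟩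

theorem expPairing_eq_integral (ξ : ℝ) (ψ : 𝓓(posHalfLine, ℝ)) :
    expPairing ξ ψ = ((∫ y, Real.exp (-(2 * Real.pi * ξ * y)) * ψ y : ℝ) : ℂ) := by
  rw [← integral_complex_ofReal, expPairing]
  refine (setIntegral_eq_integral_of_forall_compl_eq_zero fun y hy => ?_).trans ?_
  · simp [testFunction_eq_zero_of_nonpos ψ (not_lt.1 hy)]
  · simp

/-- A test function orthogonal to `e^{-2πξy}` is of the form `θ' - 2πξθ`. -/
theorem exists_testFunction_ode (ξ : ℝ) (ψ : 𝓓(posHalfLine, ℝ)) (h : expPairing ξ ψ = 0) :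
    ∃ θ : 𝓓(posHalfLine, ℝ), ψ = derivTest θ - (2 * Real.pi * ξ) • θ := by
  obtain ⟨a, b, ha, hab, hs⟩ := exists_tsupport_subset_Icc ψ
  set c : ℝ := 2 * Real.pi * ξ with hc
  let w : ℝ → ℝ := fun y => Real.exp (-(c * y)) * ψ y
  have hwc : Continuous w := by
    have := ψ.continuous
    fun_prop
  have hw0 : ∀ y, y ∉ Icc a b → w y = 0 := fun y hy => by
    have : ψ y = 0 := image_eq_zero_of_notMem_tsupport fun h => hy (hs h)
    simp [w, this]
  have hwd : ContDiff ℝ (⊤ : ℕ∞) w := by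
    have := ψ.contDiff
    fun_prop
  -- Variation of constants: `θ' - cθ = ψ` means `(e^{-cy} θ)' = e^{-cy} ψ`, so `θ = e^{cy} G`. The
  -- vanishing total integral of `w` keeps `G` supported in `[a, b]`.
  let G : ℝ → ℝ := fun y => ∫ t in a..y, w t
  have hGd : ∀ y, HasDerivAt G (w y) y := fun y =>
    intervalIntegral.integral_hasDerivAt_right (hwc.intervalIntegrable _ _)
      (hwc.stronglyMeasurableAtFilter _ _) hwc.continuousAt
  have hGs : ContDiff ℝ (⊤ : ℕ∞) G := by
    rw [contDiff_infty_iff_deriv]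
    refine ⟨fun y => (hGd y).differentiableAt, ?_⟩
    have : deriv G = w := funext fun y => (hGd y).deriv
    rwa [this]
  have hint : ∫ t in a..b, w t = 0 := by
    have h1 : ∫ y, w y = 0 := by
      have := (expPairing_eq_integral ξ ψ).symm.trans h
      exact_mod_cast this
    rw [intervalIntegral.integral_of_le hab, ← integral_Icc_eq_integral_Ioc, ← h1]
    exact setIntegral_eq_integral_of_forall_compl_eq_zero hw0
  have hG0 : ∀ y, y ∉ Icc a b → G y = 0 := by
    intro y hy
    rcases lt_or_ge y a with hya | hya
    · refine intervalIntegral.integral_zero_ae (ae_of_all _ fun t ht => ?_)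
      rw [uIoc_of_ge hya.le] at ht
      rcases ht.2.lt_or_eq with h1 | h1
      · exact hw0 t fun h2 => absurd h2.1 (not_le.2 h1)
      -- The endpoint `a` belongs to `Icc a b`; the value of `w` there is found by continuity from
      -- the left.
      · have : a ∈ closure (Iio a) := by simp
        have hcl : IsClosed {t | w t = 0} := isClosed_eq hwc continuous_const
        rw [h1]
        exact closure_minimal (fun s hs => hw0 s fun h2 => absurd h2.1 (not_le.2 hs)) hcl this
    · have hyb : b < y := by
        by_contra hcon
        exact hy ⟨hya, not_lt.1 hcon⟩
      have : G y = (∫ t in a..b, w t) + ∫ t in b..y, w t :=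
        (intervalIntegral.integral_add_adjacent_intervals (hwc.intervalIntegrable _ _)
          (hwc.intervalIntegrable _ _)).symm
      rw [this, hint, zero_add]
      refine intervalIntegral.integral_zero_ae (ae_of_all _ fun t ht => ?_)
      rw [uIoc_of_le hyb.le] at ht
      exact hw0 t fun h2 => absurd h2.2 (not_le.2 ht.1)
  let θf : ℝ → ℝ := fun y => Real.exp (c * y) * G y
  have hθ0 : tsupport θf ⊆ Icc a b := by
    refine closure_minimal (fun y hy => ?_) isClosed_Icc
    by_contra hcon
    exact hy (by simp [θf, hG0 y hcon])
  let θ : 𝓓(posHalfLine, ℝ) := ⟨θf, by fun_prop,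
    isCompact_Icc.of_isClosed_subset (isClosed_tsupport _) hθ0,
    hθ0.trans fun y hy => ha.trans_le hy.1⟩
  refine ⟨θ, ?_⟩
  ext y
  have hd : HasDerivAt θf (Real.exp (c * y) * (c * 1) * G y + Real.exp (c * y) * w y) y :=
    ((((hasDerivAt_id y).const_mul c).exp)).mul (hGd y)
  have h1 : derivTest θ y = c * θf y + ψ y := by
    rw [derivTest_apply]
    refine hd.deriv.trans ?_
    have : Real.exp (c * y) * w y = ψ y := by
      simp only [w]
      rw [← mul_assoc, ← Real.exp_add]
      simp
    rw [this]
    simp only [θf]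
    ring
  have h2 : (derivTest θ - c • θ) y = derivTest θ y - c * θf y := rfl
  rw [h2, h1]
  ring

theorem continuous_expPairing (ψ : 𝓓(posHalfLine, ℝ)) : Continuous fun ξ => expPairing ξ ψ := by
  obtain ⟨a, b, -, -, hs⟩ := exists_tsupport_subset_Icc ψ
  have h : ∀ ξ, expPairing ξ ψ =
      ((∫ y in Icc a b, Real.exp (-(2 * Real.pi * ξ * y)) * ψ y : ℝ) : ℂ) := fun ξ => by
    rw [expPairing_eq_integral, setIntegral_eq_integral_of_forall_compl_eq_zero]
    intro y hy
    rw [image_eq_zero_of_notMem_tsupport fun h => hy (hs h), mul_zero]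
  simp only [h]
  refine Complex.continuous_ofReal.comp
    (continuous_parametric_integral_of_continuous ?_ isCompact_Icc)
  have := ψ.continuous
  fun_prop

/-- Within distance `r` of `c` the exponential is at least its value at `c` times `e^{-2π|ξ|r}`; `m`
is the integral of the bump. This converts bounds on pairings into pointwise bounds on the symbol.
-/
theorem exists_bump {c r : ℝ} (hr : 0 < r) (hrc : r < c) :
    ∃ ψ : 𝓓(posHalfLine, ℝ), (∀ y, 0 ≤ ψ y) ∧ tsupport ψ ⊆ Metric.closedBall c r ∧ ψ c = 1 ∧
      ∃ m > 0, ∀ ξ, m * Real.exp (-(2 * Real.pi * ξ * c) - 2 * Real.pi * |ξ| * r) ≤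
        ‖expPairing ξ ψ‖ := by
  let b : ContDiffBump c := ⟨r / 2, r, by positivity, by linarith⟩
  have hts : tsupport b ⊆ Metric.closedBall c r := b.tsupport_eq.subset
  have hpos : Metric.closedBall c r ⊆ Ioi (0 : ℝ) := fun y hy => by
    rw [Metric.mem_closedBall, Real.dist_eq, abs_le] at hy
    simp only [mem_Ioi]
    linarith [hy.1]
  let ψ : 𝓓(posHalfLine, ℝ) := ⟨b, b.contDiff, b.hasCompactSupport, hts.trans hpos⟩
  have hψ : ∀ y, ψ y = b y := fun _ => rfl
  have hψ1 : ψ c = 1 := b.one_of_mem_closedBall (Metric.mem_closedBall_self (by positivity))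
  have hψ0 : ∀ y, 0 ≤ ψ y := fun y => b.nonneg
  have hψc := ψ.continuous
  have hm : 0 < ∫ y, ψ y := hψc.integral_pos_of_hasCompactSupport_nonneg_nonzero (x := c)
    ψ.hasCompactSupport hψ0 (by rw [hψ1]; norm_num)
  refine ⟨ψ, hψ0, hts, hψ1, ∫ y, ψ y, hm, fun ξ => ?_⟩
  rw [expPairing_eq_integral, Complex.norm_real, mul_comm, ← integral_const_mul]
  refine le_trans (integral_mono ?_ ?_ fun y => ?_) (Real.le_norm_self _)
  · exact (hψc.integrable_of_hasCompactSupport ψ.hasCompactSupport).const_mul _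
  · exact Continuous.integrable_of_hasCompactSupport (by fun_prop) ψ.hasCompactSupport.mul_left
  · simp only
    by_cases hy : y ∈ tsupport ψ
    · refine mul_le_mul_of_nonneg_right (Real.exp_le_exp.2 ?_) (hψ0 y)
      have h1 : |y - c| ≤ r := by simpa [Real.dist_eq] using hts hy
      have h2 : ξ * (y - c) ≤ |ξ| * r := (le_abs_self _).trans (by rw [abs_mul]; gcongr)
      nlinarith [mul_le_mul_of_nonneg_left h2 Real.two_pi_pos.le]
    · simp [image_eq_zero_of_notMem_tsupport hy]

/-! ### The weight `ρ` and the symbol `û₀` -/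

theorem IsExp.rho_eq {ι : UniformEmbedding X} {ξ : ℝ} {x : X} (hx : IsExp ι ξ x) :
    rho ι ξ = ‖x‖ₑ := by
  refine le_antisymm (iInf₂_le x hx) (le_iInf₂ fun y hy => ?_)
  have : x = y := ι.injective (by ext ψ; exact (hx ψ).trans (hy ψ).symm)
  rw [this]

theorem rho_eq_top_of_not_exists {ι : UniformEmbedding X} {ξ : ℝ} (h : ¬∃ x, IsExp ι ξ x) :
    rho ι ξ = ∞ := by
  push Not at h
  simp [rho, h]

theorem isExp_inv_smul {ι : UniformEmbedding X} {ξ : ℝ} {x : X} {c : ℂ} (hc : c ≠ 0)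
    (h : ∀ ψ, ι.toDist x ψ = c * expPairing ξ ψ) : IsExp ι ξ (c⁻¹ • x) := fun ψ => by
  rw [map_smul]
  change c⁻¹ * ι.toDist x ψ = _
  rw [h, inv_mul_cancel_left₀ hc]

theorem toDist_eq_zero_iff {ι : UniformEmbedding X} {x : X} :
    (∀ ψ, ι.toDist x ψ = 0) ↔ x = 0 := by
  refine ⟨fun h => ι.injective ?_, fun h ψ => by rw [h]; simp⟩
  rw [map_zero]
  ext ψ
  exact h ψ

/-- A nonzero multiple of the exponential in `X` can be rescaled to put the exponential itself in
`X`. -/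
theorem eq_zero_of_rho_eq_top {ι : UniformEmbedding X} {ξ : ℝ} {x : X} {c : ℂ}
    (h : ∀ ψ, ι.toDist x ψ = c * expPairing ξ ψ) (hρ : rho ι ξ = ∞) : c = 0 := by
  by_contra hc
  rw [(isExp_inv_smul hc h).rho_eq] at hρ
  exact enorm_ne_top hρ

/-- The pointwise form of the isometry `‖û‖ = ‖û₀ ρ‖_q`. -/
theorem norm_eq_mul_rho {ι : UniformEmbedding X} {ξ : ℝ} {x : X} {c : ℂ}
    (h : ∀ ψ, ι.toDist x ψ = c * expPairing ξ ψ) : ‖x‖ = ‖c‖ * (rho ι ξ).toReal := by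
  by_cases hc : c = 0
  · have : x = 0 := toDist_eq_zero_iff.1 fun ψ => by rw [h, hc, zero_mul]
    simp [this, hc]
  · rw [(isExp_inv_smul hc h).rho_eq, toReal_enorm, norm_smul, norm_inv,
      mul_inv_cancel_left₀ (norm_ne_zero_iff.2 hc)]

/-- A distribution that kills every `θ' - 2πξθ` kills all test functions orthogonal to `e^{-2πξ·}`,
hence is a multiple of it. The multiple is read off from one bump `ψ₀` whose pairing with the
exponentials is continuous in `ξ` and never zero, so the quotient stays locally integrable. -/
theorem exists_locallyIntegrable_symbol {ι : UniformEmbedding X} {q : ℝ≥0∞} [Fact (1 ≤ q)]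
    {u : SemiTempered} {f : Lp X q (volume : Measure ℝ)}
    (hf : IsGivenBy ι (partialFourier u) f) {F : ℂ → ℂ} (hF : DifferentiableOn ℂ F upper)
    (hu : IsFunction u F) :
    ∃ g : ℝ → ℂ, LocallyIntegrable g volume ∧
      ∀ᵐ ξ : ℝ, ∀ ψ, ι.toDist (f ξ) ψ = g ξ * expPairing ξ ψ := by
  obtain ⟨ψ₀, -, -, -, m, hm, hE⟩ := exists_bump (c := 2) (r := 1) one_pos (by norm_num)
  have hE0 : ∀ ξ, expPairing ξ ψ₀ ≠ 0 := fun ξ h => by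
    have := hE ξ
    rw [h, norm_zero] at this
    exact absurd this (not_le.2 (by positivity))
  refine ⟨fun ξ => (expPairing ξ ψ₀)⁻¹ * ι.toDist (f ξ) ψ₀, ?_, ?_⟩
  · have h := locallyIntegrable_pairing ι f ψ₀
    rw [← locallyIntegrableOn_univ] at h ⊢
    exact h.continuousOn_mul ((continuous_expPairing ψ₀).inv₀ hE0).continuousOn
      isOpen_univ.isLocallyClosed
  · filter_upwards [hf.ae_forall_deriv hF hu] with ξ h ψ
    set k : ℝ := ∫ y, Real.exp (-(2 * Real.pi * ξ * y)) * ψ y with hk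
    set k₀ : ℝ := ∫ y, Real.exp (-(2 * Real.pi * ξ * y)) * ψ₀ y with hk₀
    have e1 : expPairing ξ ψ = k := expPairing_eq_integral ξ ψ
    have e0 : expPairing ξ ψ₀ = k₀ := expPairing_eq_integral ξ ψ₀
    have hk0 : k₀ ≠ 0 := fun h => hE0 ξ (by rw [e0, h, Complex.ofReal_zero])
    have hint : ∀ χ : 𝓓(posHalfLine, ℝ),
        Integrable fun y => Real.exp (-(2 * Real.pi * ξ * y)) * χ y := fun χ => by
      have := χ.continuous
      exact Continuous.integrable_of_hasCompactSupport (by fun_prop) χ.hasCompactSupport.mul_left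
    have hz : expPairing ξ (ψ - (k / k₀) • ψ₀) = 0 := by
      have h1 : ∀ y, Real.exp (-(2 * Real.pi * ξ * y)) * (ψ - (k / k₀) • ψ₀) y =
          Real.exp (-(2 * Real.pi * ξ * y)) * ψ y -
            (k / k₀) * (Real.exp (-(2 * Real.pi * ξ * y)) * ψ₀ y) := fun y => by
        have : (ψ - (k / k₀) • ψ₀) y = ψ y - (k / k₀) * ψ₀ y := rfl
        rw [this]
        ring
      rw [expPairing_eq_integral]
      simp only [h1]
      rw [integral_sub (hint ψ) ((hint ψ₀).const_mul _), integral_const_mul, ← hk, ← hk₀,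
        div_mul_cancel₀ _ hk0, sub_self, Complex.ofReal_zero]
    obtain ⟨θ, hθ⟩ := exists_testFunction_ode ξ _ hz
    have h2 : ι.toDist (f ξ) (ψ - (k / k₀) • ψ₀) = 0 := by
      rw [hθ, map_sub, map_smul, Complex.real_smul]
      push_cast
      exact h θ
    rw [map_sub, map_smul, Complex.real_smul, sub_eq_zero] at h2
    rw [h2, e1, e0]
    push_cast
    field_simp

theorem existsUnique_isSymbol {ι : UniformEmbedding X} {q : ℝ≥0∞} [Fact (1 ≤ q)]
    (u : bergmanSpace ι q) : ∃! g : weightedSpace ι q, IsSymbol u g := by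
  obtain ⟨F, hF, hu⟩ := u.2
  have hf := transform_spec ι q (u : MixedSpace ι q)
  set f := transform ι q (u : MixedSpace ι q) with hfdef
  obtain ⟨g, hgl, hg⟩ := exists_locallyIntegrable_symbol hf hF hu
  have hgm : AEStronglyMeasurable g volume := hgl.aestronglyMeasurable
  let G : ℝ →ₘ[volume] ℂ := AEEqFun.mk g hgm
  have hG : G =ᵐ[volume] g := AEEqFun.coeFn_mk g hgm
  have hGs : ∀ᵐ ξ, ∀ ψ, ι.toDist (f ξ) ψ = G ξ * expPairing ξ ψ := by
    filter_upwards [hg, hG] with ξ h1 h2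
    rwa [h2]
  have hmeas : AEStronglyMeasurable (fun ξ => G ξ * ((rho ι ξ).toReal : ℂ)) volume := by
    -- Measurability of `ρ` itself is not available, but `|G| ρ = ‖f‖` gives `G ρ = (G / |G|) ‖f‖`.
    have h1 : AEStronglyMeasurable (fun ξ => G ξ * (((‖G ξ‖ : ℝ) : ℂ)⁻¹ * (‖f ξ‖ : ℂ))) volume := by
      have h2 : AEMeasurable (fun ξ => ((‖G ξ‖ : ℝ) : ℂ)⁻¹) volume :=
        (Complex.measurable_ofReal.comp_aemeasurable G.aestronglyMeasurable.norm.aemeasurable).inv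
      exact G.aestronglyMeasurable.mul (h2.aestronglyMeasurable.mul
        (Complex.continuous_ofReal.comp_aestronglyMeasurable (Lp.aestronglyMeasurable f).norm))
    refine h1.congr ?_
    filter_upwards [hGs] with ξ h
    by_cases hc : G ξ = 0
    · simp [hc]
    · rw [norm_eq_mul_rho h]
      have : (‖G ξ‖ : ℂ) ≠ 0 := by exact_mod_cast norm_ne_zero_iff.2 hc
      push_cast
      field_simp
  have hmem : G ∈ weightedSpace ι q := by
    refine ⟨hgl.congr hG.symm, ?_, (Lp.memLp f).congr_norm hmeas ?_⟩
    · filter_upwards [hGs] with ξ h1 h2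
      exact eq_zero_of_rho_eq_top h1 h2
    · filter_upwards [hGs] with ξ h
      rw [norm_eq_mul_rho h]
      simp
  refine ⟨⟨G, hmem⟩, hGs, fun g' hg' => Subtype.ext (AEEqFun.ext ?_)⟩
  filter_upwards [hGs, hg'] with ξ h1 h2
  obtain ⟨ψ, hψ⟩ := exists_testFunction_expPairing_ne_zero ξ
  exact mul_right_cancel₀ hψ ((h2 ψ).symm.trans (h1 ψ))

theorem IsSymbol.norm_eq {ι : UniformEmbedding X} {q : ℝ≥0∞} [Fact (1 ≤ q)]
    {u : bergmanSpace ι q} {g : weightedSpace ι q} (h : IsSymbol u g) : ‖g‖ = ‖u‖ := by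
  have h1 : ‖u‖ = ‖transform ι q (u : MixedSpace ι q)‖ := rfl
  rw [h1, norm_weightedSpace_def, Lp.norm_def, Lp.norm_def]
  congr 1
  refine eLpNorm_congr_norm_ae ?_
  filter_upwards [h, weightMul_coeFn g] with ξ h1 h2
  rw [h2, norm_eq_mul_rho h1]
  simp

/-! ### The holomorphic function with a given symbol -/

theorem integrable_exp_neg_mul_abs {c : ℝ} (hc : 0 < c) :
    Integrable fun ξ : ℝ => Real.exp (-(c * |ξ|)) := by
  rw [← integrableOn_univ, ← Iic_union_Ioi (a := (0 : ℝ))]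
  refine IntegrableOn.union ?_ ?_
  · refine (integrableOn_exp_mul_Iic hc 0).congr_fun (fun ξ hξ => ?_) measurableSet_Iic
    simp only [abs_of_nonpos (mem_Iic.1 hξ), mul_neg, neg_neg]
  · refine (integrableOn_exp_mul_Ioi (neg_lt_zero.2 hc) 0).congr_fun (fun ξ hξ => ?_)
      measurableSet_Ioi
    simp only [abs_of_pos (mem_Ioi.1 hξ), neg_mul]

theorem memLp_exp_neg_mul_abs {c : ℝ} (hc : 0 < c) (p : ℝ≥0∞) :
    MemLp (fun ξ : ℝ => Real.exp (-(c * |ξ|))) p volume := by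
  have hm : AEStronglyMeasurable (fun ξ : ℝ => Real.exp (-(c * |ξ|))) volume :=
    Continuous.aestronglyMeasurable (by fun_prop)
  rcases eq_or_ne p ∞ with rfl | hp
  · refine memLp_top_of_bound hm 1 (ae_of_all _ fun ξ => ?_)
    rw [Real.norm_of_nonneg (Real.exp_pos _).le, Real.exp_le_one_iff]
    have := abs_nonneg ξ
    simp only [Left.neg_nonpos_iff]
    positivity
  rcases eq_or_ne p 0 with rfl | hp0
  · exact memLp_zero_iff_aestronglyMeasurable.2 hm
  · rw [← integrable_norm_rpow_iff hm hp0 hp]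
    have h := integrable_exp_neg_mul_abs (mul_pos hc (ENNReal.toReal_pos hp0 hp))
    refine h.congr (ae_of_all _ fun ξ => ?_)
    simp only
    rw [Real.norm_of_nonneg (Real.exp_pos _).le, ← Real.exp_mul]
    congr 1
    ring

/-- Exponential integrability of a symbol `g` for which all `g ⟨e^{-2πξ·}, ψ⟩` are in `L^q`. -/
theorem exists_integrable_exp_of_memLp {q : ℝ≥0∞} [Fact (1 ≤ q)] {g : ℝ → ℂ}
    (hgm : AEStronglyMeasurable g volume)
    (hg : ∀ ψ, MemLp (fun ξ => g ξ * expPairing ξ ψ) q volume) {y : ℝ} (hy : 0 < y) :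
    ∃ s > 0, Integrable fun ξ : ℝ => ‖g ξ‖ * Real.exp (-(2 * Real.pi * ξ * y) + 2 * Real.pi * |ξ| * s) := by
  have hA : ∀ c r : ℝ, 0 < r → r < c → MemLp (fun ξ : ℝ => ‖g ξ‖ *
      Real.exp (-(2 * Real.pi * ξ * c) - 2 * Real.pi * |ξ| * r)) q volume := by
    intro c r hr hrc
    obtain ⟨ψ, -, -, -, m, hm, hE⟩ := exists_bump hr hrc
    refine (hg ψ).of_le_mul (c := m⁻¹) ?_ (ae_of_all _ fun ξ => ?_)
    · exact hgm.norm.mul (Continuous.aestronglyMeasurable (by fun_prop))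
    · rw [norm_mul, norm_mul, norm_norm, Real.norm_of_nonneg (Real.exp_pos _).le, mul_left_comm]
      refine mul_le_mul_of_nonneg_left ?_ (norm_nonneg _)
      rw [le_inv_mul_iff₀ hm]
      exact hE ξ
  -- The height `y / 2` controls `ξ ≥ 0` and the height `3y / 2` controls `ξ ≤ 0`. Each beats
  -- `e^{-2πξy}` by `e^{2π|ξ| · 3y/8}`, where `3y/8 = y/2 - y/8`.
  have h1 := hA (y - y / 2) (y / 8) (by linarith) (by linarith)
  have h2 := hA (y + y / 2) (y / 8) (by linarith) (by linarith)
  have h3 : MemLp (fun ξ : ℝ => ‖g ξ‖ *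
      Real.exp (-(2 * Real.pi * ξ * y) + 2 * Real.pi * |ξ| * (3 * y / 8))) q volume := by
    refine (h1.add h2).of_le ?_ (ae_of_all _ fun ξ => ?_)
    · exact hgm.norm.mul (Continuous.aestronglyMeasurable (by fun_prop))
    · simp only [Pi.add_apply]
      rw [← mul_add, norm_mul, norm_mul, norm_norm, Real.norm_of_nonneg (Real.exp_pos _).le,
        Real.norm_of_nonneg (by positivity)]
      refine mul_le_mul_of_nonneg_left ?_ (norm_nonneg _)
      rcases le_total 0 ξ with h | h
      · refine le_add_of_le_of_nonneg (Real.exp_le_exp.2 (le_of_eq ?_)) (Real.exp_pos _).le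
        rw [abs_of_nonneg h]
        ring
      · refine le_add_of_nonneg_of_le (Real.exp_pos _).le (Real.exp_le_exp.2 (le_of_eq ?_))
        rw [abs_of_nonpos h]
        ring
  have : ENNReal.HolderConjugate (ENNReal.conjExponent q) q :=
    (ENNReal.HolderConjugate.conjExponent (Fact.out : 1 ≤ q)).symm
  -- Spending `y / 8` of the surplus on a factor in the dual `L^{q'}` gives integrability by Hölder
  -- and leaves `s = 3y/8 - y/8 = y/4`.
  have h4 := memLp_exp_neg_mul_abs (c := 2 * Real.pi * (y / 8)) (by positivity)
    (ENNReal.conjExponent q)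
  refine ⟨y / 4, by positivity, (h4.integrable_mul h3).congr (ae_of_all _ fun ξ => ?_)⟩
  simp only [Pi.mul_apply]
  rw [mul_left_comm, ← Real.exp_add]
  congr 2
  ring

/-- The holomorphic extension `z ↦ ∫ g(ξ) e^{2πiξz} dξ`. -/
def holExt (g : ℝ → ℂ) (z : ℂ) : ℂ := ∫ ξ : ℝ, g ξ * Complex.exp (2 * Real.pi * Complex.I * ξ * z)

theorem norm_exp_holExt (ξ : ℝ) (z : ℂ) :
    ‖Complex.exp (2 * Real.pi * Complex.I * ξ * z)‖ = Real.exp (-(2 * Real.pi * ξ * z.im)) := by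
  rw [Complex.norm_exp]
  congr 1
  simp

theorem integrable_norm_mul_exp {q : ℝ≥0∞} [Fact (1 ≤ q)] {g : ℝ → ℂ}
    (hgm : AEStronglyMeasurable g volume)
    (hg : ∀ ψ, MemLp (fun ξ => g ξ * expPairing ξ ψ) q volume) {y : ℝ} (hy : 0 < y) :
    Integrable fun ξ : ℝ => ‖g ξ‖ * Real.exp (-(2 * Real.pi * ξ * y)) := by
  obtain ⟨s, hs, h⟩ := exists_integrable_exp_of_memLp hgm hg hy
  refine h.mono (hgm.norm.mul (Continuous.aestronglyMeasurable (by fun_prop)))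
    (ae_of_all _ fun ξ => ?_)
  rw [norm_mul, norm_mul]
  refine mul_le_mul_of_nonneg_left ?_ (norm_nonneg _)
  rw [Real.norm_of_nonneg (Real.exp_pos _).le, Real.norm_of_nonneg (Real.exp_pos _).le]
  exact Real.exp_le_exp.2 (le_add_of_nonneg_right (by positivity))

/-- Differentiation under the integral. Half of the surplus `s` absorbs the factor `2π|ξ|` from the
derivative, the other half the variation of the height over a ball of radius `s / 2`. -/
theorem differentiableOn_holExt {q : ℝ≥0∞} [Fact (1 ≤ q)] {g : ℝ → ℂ}
    (hgm : AEStronglyMeasurable g volume)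
    (hg : ∀ ψ, MemLp (fun ξ => g ξ * expPairing ξ ψ) q volume) :
    DifferentiableOn ℂ (holExt g) upper := by
  intro z hz
  obtain ⟨s, hs, h⟩ := exists_integrable_exp_of_memLp hgm hg hz
  have hmeas : ∀ w : ℂ, AEStronglyMeasurable
      (fun ξ : ℝ => g ξ * Complex.exp (2 * Real.pi * Complex.I * ξ * w)) volume := fun w =>
    hgm.mul (Continuous.aestronglyMeasurable (by fun_prop))
  have hint : Integrable (fun ξ : ℝ => g ξ * Complex.exp (2 * Real.pi * Complex.I * ξ * z)) := by
    refine (integrable_norm_mul_exp hgm hg hz).mono (hmeas z) (ae_of_all _ fun ξ => ?_)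
    rw [norm_mul, norm_exp_holExt, norm_mul, norm_norm, Real.norm_of_nonneg (Real.exp_pos _).le]
  refine (hasDerivAt_integral_of_dominated_loc_of_deriv_le (s := Metric.ball z (s / 2))
    (bound := fun ξ => (2 / s) * (‖g ξ‖ *
      Real.exp (-(2 * Real.pi * ξ * z.im) + 2 * Real.pi * |ξ| * s)))
    (F' := fun w ξ => g ξ * (Complex.exp (2 * Real.pi * Complex.I * ξ * w) *
      (2 * Real.pi * Complex.I * ξ)))
    (Metric.ball_mem_nhds z (by positivity)) (Eventually.of_forall hmeas) hint
    (hgm.mul (Continuous.aestronglyMeasurable (by fun_prop))) (ae_of_all _ fun ξ w hw => ?_)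
    (h.const_mul _) (ae_of_all _ fun ξ w _ => ?_)).2.differentiableAt.differentiableWithinAt
  · rw [norm_mul, norm_mul, norm_exp_holExt, mul_left_comm (2 / s)]
    refine mul_le_mul_of_nonneg_left ?_ (norm_nonneg _)
    have hn : ‖(2 * Real.pi * Complex.I * ξ : ℂ)‖ = 2 * Real.pi * |ξ| := by
      simp [abs_of_pos Real.pi_pos]
    rw [hn]
    have h1 : 2 * Real.pi * |ξ| ≤ (2 / s) * Real.exp (2 * Real.pi * |ξ| * (s / 2)) := by
      rw [div_mul_eq_mul_div, le_div_iff₀ hs]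
      linarith [Real.add_one_le_exp (2 * Real.pi * |ξ| * (s / 2))]
    have h2 : Real.exp (-(2 * Real.pi * ξ * w.im)) ≤
        Real.exp (-(2 * Real.pi * ξ * z.im) + 2 * Real.pi * |ξ| * (s / 2)) := by
      refine Real.exp_le_exp.2 ?_
      have h3 : |w.im - z.im| ≤ s / 2 := by
        have h5 : ‖w - z‖ < s / 2 := mem_ball_iff_norm.1 hw
        have := (Complex.abs_im_le_norm (w - z)).trans h5.le
        simpa using this
      have h4 : -(ξ * (w.im - z.im)) ≤ |ξ| * (s / 2) :=
        (neg_le_abs _).trans (by rw [abs_mul]; gcongr)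
      nlinarith [mul_le_mul_of_nonneg_left h4 Real.two_pi_pos.le]
    calc Real.exp (-(2 * Real.pi * ξ * w.im)) * (2 * Real.pi * |ξ|)
        ≤ Real.exp (-(2 * Real.pi * ξ * z.im) + 2 * Real.pi * |ξ| * (s / 2)) *
          ((2 / s) * Real.exp (2 * Real.pi * |ξ| * (s / 2))) := by gcongr
      _ = (2 / s) * Real.exp (-(2 * Real.pi * ξ * z.im) + 2 * Real.pi * |ξ| * s) := by
          rw [mul_left_comm, ← Real.exp_add]
          congr 2
          ring
  · have h1 : HasDerivAt (fun w : ℂ => 2 * Real.pi * Complex.I * ξ * w)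
        (2 * Real.pi * Complex.I * ξ) w := by
      simpa using (hasDerivAt_id w).const_mul (2 * Real.pi * Complex.I * ξ : ℂ)
    exact h1.cexp.const_mul (g ξ)

theorem fourierInv_schwartz_apply (φ : 𝓢(ℝ, ℂ)) (ξ : ℝ) :
    (𝓕⁻ φ) ξ = ∫ x : ℝ, Complex.exp (2 * Real.pi * Complex.I * ξ * x) * φ x := by
  rw [SchwartzMap.fourierInv_coe, Real.fourierInv_eq']
  refine integral_congr_ae (ae_of_all _ fun x => ?_)
  simp only [smul_eq_mul]
  congr 2
  simp
  ring

/-- Applying the formula for `û` to `𝓕⁻ φ` recovers `u φ`; expanding `𝓕⁻ φ` and the exponential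
pairing as integrals, the claim is Fubini's theorem. -/
theorem isFunction_holExt {q : ℝ≥0∞} [Fact (1 ≤ q)] {ι : UniformEmbedding X} {u : SemiTempered}
    {f : Lp X q (volume : Measure ℝ)} (hf : IsGivenBy ι (partialFourier u) f) {g : ℝ → ℂ}
    (hgm : AEStronglyMeasurable g volume)
    (hg : ∀ ψ, MemLp (fun ξ => g ξ * expPairing ξ ψ) q volume)
    (hfg : ∀ᵐ ξ, ∀ ψ, ι.toDist (f ξ) ψ = g ξ * expPairing ξ ψ) : IsFunction u (holExt g) := by
  intro φ _ ψ
  have h1 : u φ ψ = ∫ ξ, (𝓕⁻ φ) ξ * (g ξ * expPairing ξ ψ) := by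
    have h2 := hf (𝓕⁻ φ) ψ
    have h3 : partialFourier u (𝓕⁻ φ) = u φ := by simp [partialFourier]
    rw [h3] at h2
    rw [h2]
    refine integral_congr_ae ?_
    filter_upwards [hfg] with ξ h
    rw [h]
  rw [h1, setIntegral_product ((subset_tsupport ψ).trans ψ.tsupport_subset)]
  obtain ⟨a, b, ha, hab, hs⟩ := exists_tsupport_subset_Icc ψ
  let K : ℝ × ℝ → ℝ → ℂ := fun z ξ => g ξ *
    Complex.exp (2 * Real.pi * Complex.I * ξ * (z.1 + z.2 * Complex.I)) * (φ z.1 * (ψ z.2 : ℂ))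
  have hint : Integrable (Function.uncurry K) ((volume : Measure (ℝ × ℝ)).prod volume) := by
    have hd1 : Integrable (fun z : ℝ × ℝ => ‖φ z.1‖ * ‖ψ z.2‖) volume :=
      φ.integrable.norm.mul_prod
        (ψ.continuous.integrable_of_hasCompactSupport ψ.hasCompactSupport).norm
    -- For `y` in `[a, b]`, `e^{-2πξy}` is at most the sum of its values at the two ends, whatever
    -- the sign of `ξ`.
    have hd2 := (integrable_norm_mul_exp hgm hg ha).add
      (integrable_norm_mul_exp hgm hg (ha.trans_le hab))
    refine (hd1.mul_prod hd2).mono ?_ (ae_of_all _ fun z => ?_)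
    · refine (hgm.comp_snd.mul (Continuous.aestronglyMeasurable (by fun_prop))).mul
        (Continuous.aestronglyMeasurable ?_)
      have h1 := φ.continuous
      have h2 := ψ.continuous
      fun_prop
    · obtain ⟨⟨x, y⟩, ξ⟩ := z
      simp only [Function.uncurry_apply_pair, K, Pi.add_apply, norm_mul, norm_norm, norm_exp_holExt,
        Complex.norm_real]
      have him : ((x : ℂ) + y * Complex.I).im = y := by simp
      rw [him, mul_comm]
      by_cases hy : y ∈ tsupport ψ
      · refine mul_le_mul_of_nonneg_left ?_ (by positivity)
        rw [← mul_add, norm_mul, norm_norm]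
        refine mul_le_mul_of_nonneg_left ?_ (norm_nonneg _)
        rw [Real.norm_of_nonneg (by positivity)]
        rcases le_total 0 ξ with h | h
        · refine le_add_of_le_of_nonneg (Real.exp_le_exp.2 ?_) (Real.exp_pos _).le
          have := mul_le_mul_of_nonneg_left (hs hy).1 (mul_nonneg Real.two_pi_pos.le h)
          linarith
        · refine le_add_of_nonneg_of_le (Real.exp_pos _).le (Real.exp_le_exp.2 ?_)
          have := mul_le_mul_of_nonpos_left (hs hy).2
            (mul_nonpos_of_nonneg_of_nonpos Real.two_pi_pos.le h)
          linarith
      · simp [image_eq_zero_of_notMem_tsupport hy]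
  have h4 : ∀ z : ℝ × ℝ, holExt g (z.1 + z.2 * Complex.I) * (φ z.1 * (ψ z.2 : ℂ)) =
      ∫ ξ, K z ξ := fun z => (integral_mul_const _ _).symm
  simp only [h4]
  rw [integral_integral_swap hint]
  refine integral_congr_ae (ae_of_all _ fun ξ => ?_)
  have h5 : ∀ z : ℝ × ℝ, K z ξ = g ξ * ((Complex.exp (2 * Real.pi * Complex.I * ξ * z.1) * φ z.1) *
      ((Real.exp (-(2 * Real.pi * ξ * z.2)) * ψ z.2 : ℝ) : ℂ)) := fun z => by
    have : (2 * Real.pi * Complex.I * ξ * (z.1 + z.2 * Complex.I) : ℂ) =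
        2 * Real.pi * Complex.I * ξ * z.1 + ((-(2 * Real.pi * ξ * z.2) : ℝ) : ℂ) := by
      push_cast
      linear_combination (2 * Real.pi * ξ * z.2 : ℂ) * Complex.I_mul_I
    simp only [K]
    rw [this, Complex.exp_add]
    push_cast
    ring
  simp only [h5]
  rw [integral_const_mul, Measure.volume_eq_prod,
    integral_prod_mul (fun x : ℝ => Complex.exp (2 * Real.pi * Complex.I * ξ * x) * φ x)
      (fun y : ℝ => ((Real.exp (-(2 * Real.pi * ξ * y)) * ψ y : ℝ) : ℂ)),
    integral_complex_ofReal, ← expPairing_eq_integral, ← fourierInv_schwartz_apply]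
  ring

theorem IsSymbol.memLp {ι : UniformEmbedding X} {q : ℝ≥0∞} [Fact (1 ≤ q)]
    {f : Lp X q (volume : Measure ℝ)} {g : ℝ → ℂ}
    (hfg : ∀ᵐ ξ, ∀ ψ, ι.toDist (f ξ) ψ = g ξ * expPairing ξ ψ) (ψ : 𝓓(posHalfLine, ℝ)) :
    MemLp (fun ξ => g ξ * expPairing ξ ψ) q volume := by
  refine ((ι.evalCLM ψ).comp_memLp f).ae_eq ?_
  filter_upwards [hfg] with ξ h
  exact h ψ

/-- A holomorphic function on the half-plane is determined by its distribution. -/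
theorem IsFunction.eqOn {u : SemiTempered} {F G : ℂ → ℂ} (hF : DifferentiableOn ℂ F upper)
    (hG : DifferentiableOn ℂ G upper) (hu : IsFunction u F) (hv : IsFunction u G) :
    EqOn F G upper := by
  intro z₀ hz₀
  by_contra hne
  set x₀ := z₀.re
  set y₀ := z₀.im
  have hy₀ : 0 < y₀ := hz₀
  have hz : (x₀ + y₀ * Complex.I : ℂ) = z₀ := Complex.re_add_im z₀
  -- The conjugate factor makes the real part of `H` positive at `z₀`, hence nearby; it is then
  -- tested against nonnegative bumps supported there.
  let H : ℂ → ℂ := fun z => (starRingEnd ℂ) (F z₀ - G z₀) * (F z - G z)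
  have hHd : ContinuousOn H upper := continuousOn_const.mul (hF.sub hG).continuousOn
  have hH0 : 0 < (H z₀).re := by
    simp only [H, Complex.conj_mul']
    have : 0 < ‖F z₀ - G z₀‖ := norm_pos_iff.2 (sub_ne_zero.2 hne)
    norm_cast
    positivity
  have hHc : ContinuousAt (fun z : ℝ × ℝ => (H (z.1 + z.2 * Complex.I)).re) (x₀, y₀) := by
    have h1 : ContinuousAt H (((x₀, y₀) : ℝ × ℝ).1 + ((x₀, y₀) : ℝ × ℝ).2 * Complex.I) := by
      simp only [hz]
      exact hHd.continuousAt (isOpen_upper.mem_nhds hz₀)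
    exact Complex.continuous_re.continuousAt.comp
      (ContinuousAt.comp (f := fun z : ℝ × ℝ => (z.1 + z.2 * Complex.I : ℂ)) h1
        (Continuous.continuousAt (by fun_prop)))
  have hev : ∀ᶠ z : ℝ × ℝ in 𝓝 (x₀, y₀), 0 < (H (z.1 + z.2 * Complex.I)).re := by
    refine hHc.eventually_const_lt ?_
    simpa [hz] using hH0
  obtain ⟨ε, hε, hball⟩ := Metric.eventually_nhds_iff_ball.1 hev
  set r : ℝ := min (ε / 2) (y₀ / 2) with hr
  have hr0 : 0 < r := by positivity
  have hrε : r < ε := (min_le_left _ _).trans_lt (by linarith)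
  obtain ⟨ψ, hψ0, hψs, hψ1, -⟩ := exists_bump (c := y₀) hr0
    ((min_le_right _ _).trans_lt (by linarith))
  let b : ContDiffBump x₀ := ⟨r / 2, r, by positivity, by linarith⟩
  have hb1 : b x₀ = 1 := b.one_of_mem_closedBall (Metric.mem_closedBall_self (by positivity))
  have hbc : HasCompactSupport (fun x => (b x : ℂ)) :=
    b.hasCompactSupport.comp_left (g := fun t : ℝ => (t : ℂ)) Complex.ofReal_zero
  have hbd : ContDiff ℝ (⊤ : ℕ∞) (fun x => (b x : ℂ)) := Complex.ofRealCLM.contDiff.comp b.contDiff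
  let φ : 𝓢(ℝ, ℂ) := hbc.toSchwartzMap hbd
  have hφ : ∀ x, φ x = (b x : ℂ) := fun x => rfl
  have hint : Integrable
      (fun z : ℝ × ℝ => H (z.1 + z.2 * Complex.I) * (φ z.1 * (ψ z.2 : ℂ))) :=
    integrable_product hHd φ.continuous ψ.continuous hbc ψ.hasCompactSupport ψ.tsupport_subset
      (subset_tsupport _) (subset_tsupport _)
  have hintF := integrable_product hF.continuousOn φ.continuous ψ.continuous hbc
    ψ.hasCompactSupport ψ.tsupport_subset (subset_tsupport _) (subset_tsupport _)
  have hintG := integrable_product hG.continuousOn φ.continuous ψ.continuous hbc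
    ψ.hasCompactSupport ψ.tsupport_subset (subset_tsupport _) (subset_tsupport _)
  have hzero : ∫ z : ℝ × ℝ, H (z.1 + z.2 * Complex.I) * (φ z.1 * (ψ z.2 : ℂ)) = 0 := by
    have h1 := (hu φ hbc ψ).symm.trans (hv φ hbc ψ)
    have hsub := (subset_tsupport ψ).trans ψ.tsupport_subset
    rw [setIntegral_product hsub, setIntegral_product hsub, ← sub_eq_zero,
      ← integral_sub hintF hintG] at h1
    have h2 : ∀ z : ℝ × ℝ, H (z.1 + z.2 * Complex.I) * (φ z.1 * (ψ z.2 : ℂ)) =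
        (starRingEnd ℂ) (F z₀ - G z₀) *
          (F (z.1 + z.2 * Complex.I) * (φ z.1 * (ψ z.2 : ℂ)) -
            G (z.1 + z.2 * Complex.I) * (φ z.1 * (ψ z.2 : ℂ))) := fun z => by
      simp only [H]
      ring
    simp only [h2]
    rw [integral_const_mul, h1, mul_zero]
  have hre : ∀ z : ℝ × ℝ, (H (z.1 + z.2 * Complex.I) * (φ z.1 * (ψ z.2 : ℂ))).re =
      (H (z.1 + z.2 * Complex.I)).re * (b z.1 * ψ z.2) := fun z => by
    rw [hφ, ← Complex.ofReal_mul, Complex.re_mul_ofReal]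
  have hzero' : ∫ z : ℝ × ℝ, (H (z.1 + z.2 * Complex.I)).re * (b z.1 * ψ z.2) = 0 := by
    have h1 := integral_re hint
    simp only [RCLike.re_to_complex, hre] at h1
    rw [h1, hzero, Complex.zero_re]
  have hnn : ∀ z : ℝ × ℝ, 0 ≤ (H (z.1 + z.2 * Complex.I)).re * (b z.1 * ψ z.2) := by
    intro z
    by_cases h : b z.1 = 0 ∨ ψ z.2 = 0
    · rcases h with h | h <;> simp [h]
    · push Not at h
      refine mul_nonneg (hball z ?_).le (mul_nonneg b.nonneg (hψ0 _))
      have h1 : z.1 ∈ Metric.ball x₀ r := b.support_eq.subset h.1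
      have h2 : z.2 ∈ Metric.closedBall y₀ r := hψs (subset_tsupport _ h.2)
      rw [Metric.mem_ball, Prod.dist_eq]
      exact max_lt ((Metric.mem_ball.1 h1).trans hrε) ((Metric.mem_closedBall.1 h2).trans_lt hrε)
  have hre_int : Integrable fun z : ℝ × ℝ =>
      (H (z.1 + z.2 * Complex.I)).re * (b z.1 * ψ z.2) := by
    have h1 := hint.re
    simpa only [RCLike.re_to_complex, hre] using h1
  -- A nonnegative integrand of zero integral vanishes almost everywhere, so on a dense set,
  -- contradicting its positivity near `(x₀, y₀)`.
  have hae := (integral_eq_zero_iff_of_nonneg hnn hre_int).1 hzero'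
  have hdense := Measure.dense_of_ae hae
  have hpos : ∀ᶠ z : ℝ × ℝ in 𝓝 (x₀, y₀),
      0 < (H (z.1 + z.2 * Complex.I)).re * (b z.1 * ψ z.2) := by
    have h1 : ∀ᶠ z : ℝ × ℝ in 𝓝 (x₀, y₀), 0 < b z.1 * ψ z.2 := by
      have hc : Continuous fun z : ℝ × ℝ => b z.1 * ψ z.2 := by
        have := b.continuous
        have := ψ.continuous
        fun_prop
      refine hc.continuousAt.eventually_const_lt ?_
      simp [hb1, hψ1]
    filter_upwards [hev, h1] with z h2 h3
    exact mul_pos h2 h3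
  obtain ⟨z, hz1, hz2⟩ := mem_closure_iff_frequently.1 (hdense (x₀, y₀)) |>.and_eventually hpos |>.exists
  exact hz2.ne' hz1

/-! ### Boundedness and support -/

theorem boundednessProperty {ι : UniformEmbedding X} {q : ℝ≥0∞} [Fact (1 ≤ q)]
    (hρ : ∀ᵐ ξ : ℝ, ξ < 0 → rho ι ξ = ∞) {y₁ : ℝ} (hy₁ : 0 < y₁) :
    BoundednessProperty ι q y₁ := by
  intro u F hF hu
  obtain ⟨g, hg, -⟩ := existsUnique_isSymbol u
  have hgm := (g : ℝ →ₘ[volume] ℂ).aestronglyMeasurable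
  have hmem := IsSymbol.memLp hg
  have hFG := hu.eqOn hF (differentiableOn_holExt hgm hmem)
    (isFunction_holExt (transform_spec ι q (u : MixedSpace ι q)) hgm hmem hg)
  -- The symbol integral converges absolutely at every positive height. As `g` vanishes for `ξ < 0`,
  -- only frequencies with `e^{-2πξy} ≤ e^{-2πξy₁}` contribute.
  have hb : ∀ y ∈ Ioi y₁, ∀ x : ℝ, ‖F (x + y * Complex.I)‖ ≤
      ∫ ξ : ℝ, ‖(g : ℝ →ₘ[volume] ℂ) ξ‖ * Real.exp (-(2 * Real.pi * ξ * y₁)) := by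
    intro y hy x
    have hy0 : 0 < y := hy₁.trans hy
    rw [hFG (mem_upper hy0), holExt]
    refine (norm_integral_le_integral_norm _).trans (integral_mono_ae ?_
      (integrable_norm_mul_exp hgm hmem hy₁) ?_)
    · refine (integrable_norm_mul_exp hgm hmem hy0).congr (ae_of_all _ fun ξ => ?_)
      simp only [norm_mul, norm_exp_holExt]
      simp
    · filter_upwards [hρ, g.2.2.1] with ξ h1 h2
      rw [norm_mul, norm_exp_holExt]
      rcases lt_or_ge ξ 0 with h | h
      · simp [h2 (h1 h)]
      · refine mul_le_mul_of_nonneg_left (Real.exp_le_exp.2 ?_) (norm_nonneg _)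
        have := mul_le_mul_of_nonneg_left (le_of_lt (mem_Ioi.1 hy)) (mul_nonneg Real.two_pi_pos.le h)
        simpa using this
  refine lt_of_le_of_lt (iSup₂_le fun y hy => ?_) (ENNReal.ofReal_lt_top
    (r := ∫ ξ : ℝ, ‖(g : ℝ →ₘ[volume] ℂ) ξ‖ * Real.exp (-(2 * Real.pi * ξ * y₁))))
  rw [eLpNorm_exponent_top]
  exact eLpNormEssSup_le_of_ae_bound (ae_of_all _ (hb y hy))

theorem supportProperty {ι : UniformEmbedding X} {q : ℝ≥0∞} [Fact (1 ≤ q)]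
    (hρ : ∀ᵐ ξ : ℝ, ξ < 0 → rho ι ξ = ∞) : SupportProperty ι q := by
  intro u g _
  filter_upwards [hρ, g.2.2.1] with ξ h1 h2 h
  exact h2 (h1 h)

/-! ### The isometric isomorphism `u ↦ û₀` -/

theorem normalizedExp_of_not_exists {ι : UniformEmbedding X} {ξ : ℝ} (h : ¬∃ x, IsExp ι ξ x) :
    normalizedExp ι ξ = 0 := dif_neg h

theorem IsExp.normalizedExp_eq {ι : UniformEmbedding X} {ξ : ℝ} {x : X} (hx : IsExp ι ξ x) :
    normalizedExp ι ξ = ((‖x‖ : ℂ)⁻¹) • x := by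
  have h : ∃ x, IsExp ι ξ x := ⟨x, hx⟩
  have : h.choose = x := ι.injective (by ext ψ; exact (h.choose_spec ψ).trans (hx ψ).symm)
  rw [normalizedExp, dif_pos h, this]

/-- The norm of the exponential cancels. Where `ρ = ∞` the coefficient is zero, so the default value
of `normalizedExp` is harmless. -/
theorem toDist_smul_normalizedExp {ι : UniformEmbedding X} {ξ : ℝ} {c : ℂ}
    (hc : rho ι ξ = ∞ → c = 0) (ψ : 𝓓(posHalfLine, ℝ)) :
    ι.toDist ((c * ((rho ι ξ).toReal : ℂ)) • normalizedExp ι ξ) ψ = c * expPairing ξ ψ := by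
  by_cases h : ∃ x, IsExp ι ξ x
  · obtain ⟨x, hx⟩ := h
    have hx0 : ‖x‖ ≠ 0 := by
      have h1 := rho_ne_zero ι ξ
      rw [hx.rho_eq] at h1
      simpa using h1
    rw [hx.normalizedExp_eq, hx.rho_eq, toReal_enorm, smul_smul, mul_assoc,
      mul_inv_cancel₀ (by exact_mod_cast hx0), mul_one, map_smul, ← hx ψ]
    rfl
  · rw [hc (rho_eq_top_of_not_exists h)]
    simp

theorem norm_normalizedExp_le (ι : UniformEmbedding X) (ξ : ℝ) : ‖normalizedExp ι ξ‖ ≤ 1 := by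
  by_cases h : ∃ x, IsExp ι ξ x
  · obtain ⟨x, hx⟩ := h
    rw [hx.normalizedExp_eq, norm_smul, norm_inv, Complex.norm_real, norm_norm]
    exact inv_mul_le_one
  · simp [normalizedExp_of_not_exists h]

/-- The element with symbol `g` has transform `(gρ)` times the normalized exponential, of norm at
most `|gρ|`; its holomorphic representative is `holExt g`. -/
theorem exists_isSymbol [CompleteSpace X] {ι : UniformEmbedding X} {q : ℝ≥0∞} [Fact (1 ≤ q)]
    (hn : AEStronglyMeasurable (normalizedExp ι) (volume : Measure ℝ)) (g : weightedSpace ι q) :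
    ∃ u : bergmanSpace ι q, IsSymbol u g := by
  have hf : MemLp (fun ξ => ((g : ℝ →ₘ[volume] ℂ) ξ * ((rho ι ξ).toReal : ℂ)) •
      normalizedExp ι ξ) q volume := by
    refine g.2.2.2.of_le (g.2.2.2.1.smul hn) (ae_of_all _ fun ξ => ?_)
    rw [norm_smul]
    exact mul_le_of_le_one_right (norm_nonneg _) (norm_normalizedExp_le ι ξ)
  have hfg : ∀ᵐ ξ, ∀ ψ, ι.toDist (hf.toLp _ ξ) ψ = (g : ℝ →ₘ[volume] ℂ) ξ * expPairing ξ ψ := by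
    filter_upwards [hf.coeFn_toLp, g.2.2.1] with ξ h1 h2 ψ
    rw [h1, toDist_smul_normalizedExp h2]
  obtain ⟨u, hu⟩ := transform_surjective ι q (hf.toLp _)
  have hgm := (g : ℝ →ₘ[volume] ℂ).aestronglyMeasurable
  have hmem := IsSymbol.memLp hfg
  have hus := transform_spec ι q u
  rw [hu] at hus
  refine ⟨⟨u, holExt (g : ℝ →ₘ[volume] ℂ), differentiableOn_holExt hgm hmem,
    isFunction_holExt hus hgm hmem hfg⟩, ?_⟩
  unfold IsSymbol
  simp only [hu]
  exact hfg

/-- The linear map `u ↦ û₀`. -/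
def symbolMap (ι : UniformEmbedding X) (q : ℝ≥0∞) [Fact (1 ≤ q)] :
    bergmanSpace ι q →ₗ[ℂ] weightedSpace ι q where
  toFun u := (existsUnique_isSymbol u).choose
  map_add' u v := by
    refine ((existsUnique_isSymbol (u + v)).choose_spec.2 _ ?_).symm
    filter_upwards [(existsUnique_isSymbol u).choose_spec.1,
      (existsUnique_isSymbol v).choose_spec.1,
      Lp.coeFn_add (transform ι q (u : MixedSpace ι q)) (transform ι q (v : MixedSpace ι q)),
      AEEqFun.coeFn_add ((existsUnique_isSymbol u).choose : ℝ →ₘ[volume] ℂ)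
        ((existsUnique_isSymbol v).choose : ℝ →ₘ[volume] ℂ)] with ξ h1 h2 h3 h4 ψ
    rw [Submodule.coe_add, map_add, h3, Submodule.coe_add, h4, Pi.add_apply, Pi.add_apply, map_add,
      add_mul, ← h1, ← h2]
    rfl
  map_smul' c u := by
    refine ((existsUnique_isSymbol (c • u)).choose_spec.2 _ ?_).symm
    filter_upwards [(existsUnique_isSymbol u).choose_spec.1,
      Lp.coeFn_smul c (transform ι q (u : MixedSpace ι q)),
      AEEqFun.coeFn_smul c ((existsUnique_isSymbol u).choose : ℝ →ₘ[volume] ℂ)]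
      with ξ h1 h3 h4 ψ
    rw [Submodule.coe_smul, map_smul, h3, RingHom.id_apply, Submodule.coe_smul, h4, Pi.smul_apply,
      Pi.smul_apply, map_smul, smul_eq_mul, mul_assoc, ← h1]
    rfl

theorem isSymbol_symbolMap {ι : UniformEmbedding X} {q : ℝ≥0∞} [Fact (1 ≤ q)]
    (u : bergmanSpace ι q) : IsSymbol u (symbolMap ι q u) :=
  (existsUnique_isSymbol u).choose_spec.1

/-- The isometric isomorphism `u ↦ û₀`. -/
def symbolEquiv [CompleteSpace X] {ι : UniformEmbedding X} (q : ℝ≥0∞) [Fact (1 ≤ q)]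
    (hn : AEStronglyMeasurable (normalizedExp ι) (volume : Measure ℝ)) :
    bergmanSpace ι q ≃ₗᵢ[ℂ] weightedSpace ι q where
  toLinearEquiv := LinearEquiv.ofBijective (symbolMap ι q) (by
    refine ⟨?_, fun g => ?_⟩
    · refine (injective_iff_map_eq_zero _).2 fun u hu => ?_
      have h := (isSymbol_symbolMap u).norm_eq
      rw [hu, norm_zero] at h
      exact norm_eq_zero.1 h.symm
    · obtain ⟨u, hu⟩ := exists_isSymbol hn g
      exact ⟨u, (existsUnique_isSymbol u).unique (isSymbol_symbolMap u) hu⟩)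
  norm_map' u := (isSymbol_symbolMap u).norm_eq

theorem completeSpace_bergmanSpace [CompleteSpace X] {ι : UniformEmbedding X} {q : ℝ≥0∞}
    [Fact (1 ≤ q)] (hn : AEStronglyMeasurable (normalizedExp ι) (volume : Measure ℝ))
    (hρ : InvRhoLocallyBounded ι) : CompleteSpace (bergmanSpace ι q) := by
  have := completeSpace_weightedSpace q hρ
  exact (completeSpace_congr (e := (symbolEquiv q hn).toEquiv)
    (symbolEquiv q hn).isometry.isUniformInducing.isUniformEmbedding).2 this

/-! ### The embedding of `L^p(ν_λ)` -/

section PowerWeight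

/-- The density of `nu lam` on the half-line. -/
def powerWeight (lam y : ℝ) : ℝ := (lam + 1) * (2 * y) ^ lam

variable {lam : ℝ}

theorem powerWeight_pos (hlam : -1 < lam) {y : ℝ} (hy : 0 < y) : 0 < powerWeight lam y :=
  mul_pos (by linarith) (Real.rpow_pos_of_pos (by positivity) _)

theorem measurable_powerWeight (lam : ℝ) : Measurable (powerWeight lam) := by
  unfold powerWeight
  fun_prop

theorem continuousOn_powerWeight (lam : ℝ) : ContinuousOn (powerWeight lam) (Ioi 0) := by
  intro y hy
  have : (2 * y) ≠ 0 := (mul_pos two_pos hy).ne'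
  exact (continuousAt_const.mul ((continuousAt_const.mul continuousAt_id).rpow_const
    (Or.inl this))).continuousWithinAt

theorem measurable_ofReal_powerWeight (lam : ℝ) :
    Measurable fun y => ENNReal.ofReal (powerWeight lam y) :=
  (measurable_powerWeight lam).ennreal_ofReal

theorem nu_eq (lam : ℝ) : nu lam =
    (volume.restrict (Ioi 0)).withDensity fun y => ENNReal.ofReal (powerWeight lam y) := rfl

theorem ae_nu_iff (hlam : -1 < lam) {P : ℝ → Prop} :
    (∀ᵐ y ∂nu lam, P y) ↔ ∀ᵐ y ∂volume.restrict (Ioi 0), P y := by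
  rw [nu_eq, ae_withDensity_iff (measurable_ofReal_powerWeight lam)]
  refine ⟨fun h => ?_, fun h => h.mono fun y hy _ => hy⟩
  filter_upwards [h, ae_restrict_mem measurableSet_Ioi] with y h1 h2
  exact h1 (ENNReal.ofReal_pos.2 (powerWeight_pos hlam h2)).ne'

theorem integral_nu (hlam : -1 < lam) (g : ℝ → ℂ) :
    ∫ y, g y ∂nu lam = ∫ y in Ioi 0, (powerWeight lam y : ℂ) * g y := by
  rw [nu_eq, integral_withDensity_eq_integral_toReal_smul (measurable_ofReal_powerWeight lam)
    (ae_of_all _ fun y => ENNReal.ofReal_lt_top)]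
  refine setIntegral_congr_fun measurableSet_Ioi fun y hy => ?_
  rw [ENNReal.toReal_ofReal (powerWeight_pos hlam hy).le, Complex.real_smul]

theorem integrable_nu_iff (hlam : -1 < lam) {g : ℝ → ℂ} :
    Integrable g (nu lam) ↔ IntegrableOn (fun y => (powerWeight lam y : ℂ) * g y) (Ioi 0) := by
  rw [nu_eq, integrable_withDensity_iff_integrable_smul' (measurable_ofReal_powerWeight lam)
    (ae_of_all _ fun y => ENNReal.ofReal_lt_top)]
  refine integrableOn_congr_fun (fun y hy => ?_) measurableSet_Ioi
  rw [ENNReal.toReal_ofReal (powerWeight_pos hlam hy).le, Complex.real_smul]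

/-- On compact subsets of the half-line, the inverse of the weight is in every `L^r(nu lam)`. -/
theorem memLp_indicator_inv_powerWeight (hlam : -1 < lam) {K : Set ℝ} (hK : IsCompact K)
    (hK0 : K ⊆ Ioi 0) (r : ℝ≥0∞) :
    MemLp (K.indicator fun y => (powerWeight lam y : ℂ)⁻¹) r (nu lam) := by
  have hc : ContinuousOn (fun y => (powerWeight lam y : ℂ)⁻¹) K := by
    refine ContinuousOn.inv₀ (Complex.continuous_ofReal.comp_continuousOn
      ((continuousOn_powerWeight lam).mono hK0)) fun y hy => ?_
    exact_mod_cast (powerWeight_pos hlam (hK0 hy)).ne'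
  have hm : AEStronglyMeasurable (K.indicator fun y => (powerWeight lam y : ℂ)⁻¹) (nu lam) :=
    ((Complex.measurable_ofReal.comp (measurable_powerWeight lam)).inv.indicator
      hK.measurableSet).aestronglyMeasurable
  obtain ⟨C, hC⟩ := hK.exists_bound_of_continuousOn hc
  have hfin : nu lam K < ∞ := by
    have h1 : Integrable (K.indicator fun _ => (1 : ℂ)) (nu lam) := by
      rw [integrable_nu_iff hlam]
      have h2 : IntegrableOn (fun y => (powerWeight lam y : ℂ)) K :=
        (Complex.continuous_ofReal.comp_continuousOn
          ((continuousOn_powerWeight lam).mono hK0)).integrableOn_compact hK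
      have h3 := (h2.integrable_indicator hK.measurableSet).integrableOn (s := Ioi 0)
      refine h3.congr_fun (fun y _ => ?_) measurableSet_Ioi
      by_cases hy : y ∈ K <;> simp [hy]
    have h4 := (integrable_indicator_iff hK.measurableSet).1 h1
    have := (integrableOn_const_iff (by simp)).1 h4
    simpa using this
  refine MemLp.of_le (memLp_indicator_const r hK.measurableSet C (Or.inr hfin.ne)) hm
    (ae_of_all _ fun y => ?_)
  by_cases hy : y ∈ K
  · simp only [indicator_of_mem hy]
    exact (hC y hy).trans (Real.le_norm_self _)
  · simp [hy]

/-- Hölder against `1_K / w`, with `w` the density of `ν_λ`; integrating with respect to `ν_λ`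
cancels `w`. -/
theorem locallyIntegrableOn_of_memLp (hlam : -1 < lam) {p : ℝ≥0∞} (hp : 1 ≤ p) {f : ℝ → ℂ}
    (hf : MemLp f p (nu lam)) : LocallyIntegrableOn f (Ioi 0) := by
  rw [locallyIntegrableOn_iff isOpen_Ioi.isLocallyClosed]
  intro K hK0 hK
  have : ENNReal.HolderConjugate p (ENNReal.conjExponent p) :=
    ENNReal.HolderConjugate.conjExponent hp
  have h1 := hf.integrable_mul
    (memLp_indicator_inv_powerWeight hlam hK hK0 (ENNReal.conjExponent p))
  rw [integrable_nu_iff hlam] at h1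
  refine (h1.mono_set hK0).congr_fun (fun y hy => ?_) hK.measurableSet
  have h2 : (powerWeight lam y : ℂ) ≠ 0 := by exact_mod_cast (powerWeight_pos hlam (hK0 hy)).ne'
  simp only [Pi.mul_apply, indicator_of_mem hy]
  field_simp

theorem div_powerWeight_eq (lam : ℝ) {K : Set ℝ} {ψ : ℝ → ℝ} (h : Function.support ψ ⊆ K) :
    (fun y => (ψ y : ℂ) / (powerWeight lam y : ℂ)) =
      fun y => (ψ y : ℂ) * K.indicator (fun y => (powerWeight lam y : ℂ)⁻¹) y := by
  funext y
  by_cases hy : y ∈ K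
  · simp [hy, div_eq_mul_inv]
  · have : ψ y = 0 := by
      by_contra h0
      exact hy (h h0)
    simp [this]

theorem memLp_div_powerWeight (hlam : -1 < lam) (r : ℝ≥0∞) (ψ : 𝓓(posHalfLine, ℝ)) :
    MemLp (fun y => (ψ y : ℂ) / (powerWeight lam y : ℂ)) r (nu lam) := by
  rw [div_powerWeight_eq lam (subset_tsupport ψ)]
  have h1 : MemLp (fun y => (ψ y : ℂ)) ∞ (nu lam) := ψ.memLp_top.ofReal
  exact (memLp_indicator_inv_powerWeight hlam ψ.hasCompactSupport ψ.tsupport_subset r).mul h1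

/-- Division by the weight, as a linear map from test functions to `L^r(nu lam)`. -/
def divWeightLM (hlam : -1 < lam) (r : ℝ≥0∞) : 𝓓(posHalfLine, ℝ) →ₗ[ℝ] Lp ℂ r (nu lam) where
  toFun ψ := (memLp_div_powerWeight hlam r ψ).toLp _
  map_add' ψ χ := by
    rw [← MemLp.toLp_add]
    refine MemLp.toLp_congr _ _ (ae_of_all _ fun y => ?_)
    have h1 : (ψ + χ) y = ψ y + χ y := rfl
    beta_reduce
    rw [Pi.add_apply, h1, Complex.ofReal_add, add_div]
  map_smul' c ψ := by
    rw [RingHom.id_apply, ← MemLp.toLp_const_smul]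
    refine MemLp.toLp_congr _ _ (ae_of_all _ fun y => ?_)
    have h1 : (c • ψ) y = c * ψ y := rfl
    beta_reduce
    rw [Pi.smul_apply, h1, Complex.ofReal_mul, Complex.real_smul, mul_div_assoc]

theorem divWeightLM_coeFn (hlam : -1 < lam) (r : ℝ≥0∞) (ψ : 𝓓(posHalfLine, ℝ)) :
    divWeightLM hlam r ψ =ᵐ[nu lam] fun y => (ψ y : ℂ) / (powerWeight lam y : ℂ) :=
  MemLp.coeFn_toLp (memLp_div_powerWeight hlam r ψ)

/-- The constant is the norm of `1_K / w`, so it depends on `K` alone: sup-norm control is enough on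
test functions supported in `K`. -/
theorem norm_divWeightLM_le (hlam : -1 < lam) (r : ℝ≥0∞) {K : Set ℝ} (hK : IsCompact K)
    (hK0 : K ⊆ Ioi 0) : ∃ C, ∀ (ψ : 𝓓(posHalfLine, ℝ)) (M : ℝ), Function.support ψ ⊆ K →
      (∀ y, ‖ψ y‖ ≤ M) → ‖divWeightLM hlam r ψ‖ ≤ M * C := by
  have hind := memLp_indicator_inv_powerWeight hlam hK hK0 r
  refine ⟨‖hind.toLp _‖, fun ψ M hs hM => Lp.norm_le_mul_norm_of_ae_le_mul ?_⟩
  filter_upwards [hind.coeFn_toLp, divWeightLM_coeFn hlam r ψ] with y h1 h2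
  rw [h1, h2, congrFun (div_powerWeight_eq lam hs) y, norm_mul, Complex.norm_real]
  exact mul_le_mul_of_nonneg_right (hM y) (norm_nonneg _)

theorem continuous_divWeightLM (hlam : -1 < lam) (r : ℝ≥0∞) [Fact (1 ≤ r)] :
    Continuous (divWeightLM hlam r) := by
  -- For the inductive limit topology, continuity of a linear map is checked on the functions
  -- supported in each fixed compact `K`.
  rw [TestFunction.continuous_iff_continuous_comp]
  intro K hK
  obtain ⟨C, hC⟩ := norm_divWeightLM_le hlam r K.isCompact hK
  let Φ : ContDiffMapSupportedIn ℝ ℝ ⊤ K →ₗ[ℝ] Lp ℂ r (nu lam) :=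
    divWeightLM hlam r ∘ₗ (TestFunction.ofSupportedInCLM ℝ hK).toLinearMap
  change Continuous Φ
  refine continuous_of_continuousAt_zero Φ ?_
  let T := ContDiffMapSupportedIn.toBoundedContinuousFunctionCLM (E := ℝ) (F := ℝ) (n := ⊤)
    (K := K) ℝ
  have hN : Continuous fun ψ => ‖T ψ‖ * C := T.continuous.norm.mul continuous_const
  rw [ContinuousAt, map_zero, tendsto_zero_iff_norm_tendsto_zero]
  refine squeeze_zero (fun _ => norm_nonneg _) (fun ψ => ?_) (hN.tendsto' 0 0 (by simp))
  exact hC (TestFunction.ofSupportedIn hK ψ) _ ((subset_tsupport _).trans ψ.tsupport_subset)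
    fun y => BoundedContinuousFunction.norm_coe_le_norm (T ψ) y

/-- Division by the weight, as a map from test functions to `L^r(nu lam)`. -/
def divWeight (hlam : -1 < lam) (r : ℝ≥0∞) [Fact (1 ≤ r)] :
    𝓓(posHalfLine, ℝ) →L[ℝ] Lp ℂ r (nu lam) :=
  ⟨divWeightLM hlam r, continuous_divWeightLM hlam r⟩

theorem divWeight_coeFn (hlam : -1 < lam) (r : ℝ≥0∞) [Fact (1 ≤ r)] (ψ : 𝓓(posHalfLine, ℝ)) :
    divWeight hlam r ψ =ᵐ[nu lam] fun y => (ψ y : ℂ) / (powerWeight lam y : ℂ) :=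
  divWeightLM_coeFn hlam r ψ

theorem fact_one_le_conjExponent (p : ℝ≥0∞) [Fact (1 ≤ p)] : Fact (1 ≤ ENNReal.conjExponent p) :=
  haveI : ENNReal.HolderConjugate p (ENNReal.conjExponent p) :=
    ENNReal.HolderConjugate.conjExponent Fact.out
  ⟨ENNReal.HolderConjugate.one_le (ENNReal.conjExponent p) p⟩

attribute [local instance] fact_one_le_conjExponent

/-- The pairing of `L^p` and `L^p'`. -/
def lpMulPairing (lam : ℝ) (p : ℝ≥0∞) [Fact (1 ≤ p)] :
    Lp ℂ p (nu lam) →L[ℂ] Lp ℂ (ENNReal.conjExponent p) (nu lam) →L[ℂ] ℂ :=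
  haveI : ENNReal.HolderConjugate p (ENNReal.conjExponent p) :=
    ENNReal.HolderConjugate.conjExponent Fact.out
  (ContinuousLinearMap.mul ℂ ℂ).lpPairing (nu lam) p (ENNReal.conjExponent p)

/-- Writing `∫ f ψ dy = ∫ f (ψ / w) dν_λ` makes the embedding a duality pairing of `L^p` with
`L^{p'}`. -/
theorem lpMulPairing_divWeight (hlam : -1 < lam) (p : ℝ≥0∞) [Fact (1 ≤ p)]
    (f : Lp ℂ p (nu lam)) (ψ : 𝓓(posHalfLine, ℝ)) :
    lpMulPairing lam p f (divWeight hlam _ ψ) = ∫ y in Ioi (0 : ℝ), f y * (ψ y : ℂ) := by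
  have : ENNReal.HolderConjugate p (ENNReal.conjExponent p) :=
    ENNReal.HolderConjugate.conjExponent Fact.out
  rw [lpMulPairing, ContinuousLinearMap.lpPairing_eq_integral]
  have h1 : ∫ y, ContinuousLinearMap.mul ℂ ℂ (f y) (divWeight hlam (ENNReal.conjExponent p) ψ y)
      ∂nu lam = ∫ y, f y * ((ψ y : ℂ) / (powerWeight lam y : ℂ)) ∂nu lam := by
    refine integral_congr_ae ?_
    filter_upwards [divWeight_coeFn hlam (ENNReal.conjExponent p) ψ] with y h
    rw [ContinuousLinearMap.mul_apply', h]
  rw [h1, integral_nu hlam]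
  refine setIntegral_congr_fun measurableSet_Ioi fun y hy => ?_
  have h2 : (powerWeight lam y : ℂ) ≠ 0 := by exact_mod_cast (powerWeight_pos hlam hy).ne'
  field_simp

/-- A locally integrable function on the half-line is determined by its distribution. -/
theorem ae_eq_zero_of_forall_testFunction {f : ℝ → ℂ} (hf : LocallyIntegrableOn f (Ioi 0))
    (h : ∀ ψ : 𝓓(posHalfLine, ℝ), ∫ y in Ioi (0 : ℝ), f y * (ψ y : ℂ) = 0) :
    ∀ᵐ y ∂volume.restrict (Ioi 0), f y = 0 := by
  rw [ae_restrict_iff' measurableSet_Ioi]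
  refine isOpen_Ioi.ae_eq_zero_of_integral_contDiff_smul_eq_zero hf fun g hg hgc hgs => ?_
  let ψ : 𝓓(posHalfLine, ℝ) := ⟨g, hg, hgc, hgs⟩
  rw [← h ψ]
  symm
  refine (setIntegral_eq_integral_of_forall_compl_eq_zero fun y hy => ?_).trans ?_
  · simp [testFunction_eq_zero_of_nonpos ψ (not_lt.1 hy)]
  · refine integral_congr_ae (ae_of_all _ fun y => ?_)
    simp only [Complex.real_smul]
    exact mul_comm _ _

/-- The uniform embedding of `L^p(nu lam)` into the distributions on the half-line. -/
def powerEmbedding (hlam : -1 < lam) (p : ℝ≥0∞) [Fact (1 ≤ p)] :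
    UniformEmbedding (Lp ℂ p (nu lam)) where
  toDist :=
    { toFun := fun f => ((lpMulPairing lam p f).restrictScalars ℝ ∘L divWeight hlam _ :
        𝓓(posHalfLine, ℝ) →L[ℝ] ℂ)
      map_add' := fun f g => by
        rw [map_add]
        rfl
      map_smul' := fun c f => by
        rw [map_smul]
        rfl }
  injective := by
    refine (injective_iff_map_eq_zero _).2 fun f hf => ?_
    rw [Lp.eq_zero_iff_ae_eq_zero]
    have hz := ae_eq_zero_of_forall_testFunction
      (locallyIntegrableOn_of_memLp hlam Fact.out (Lp.memLp f)) fun ψ => by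
        rw [← lpMulPairing_divWeight hlam p f ψ]
        exact DFunLike.congr_fun hf ψ
    exact (ae_nu_iff hlam).2 hz
  bound := by
    obtain ⟨C, hC0, hC⟩ : ∃ C : ℝ, 0 ≤ C ∧ ∀ f g, ‖lpMulPairing lam p f g‖ ≤ C * ‖f‖ * ‖g‖ :=
      ⟨‖lpMulPairing lam p‖, norm_nonneg (lpMulPairing lam p),
        (lpMulPairing lam p).le_opNorm₂⟩
    -- The seminorm is `ψ ↦ C ‖ψ / w‖_{p'}` with `C` the norm of the pairing.
    refine ⟨(normSeminorm ℝ (Lp ℂ (ENNReal.conjExponent p) (nu lam))).comp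
      ((C • divWeight hlam (ENNReal.conjExponent p) :
        𝓓(posHalfLine, ℝ) →L[ℝ] _) : 𝓓(posHalfLine, ℝ) →ₗ[ℝ] _), ?_, fun f ψ => ?_⟩
    · exact (C • divWeight hlam (ENNReal.conjExponent p)).continuous.norm
    · refine (hC f (divWeight hlam _ ψ)).trans (le_of_eq ?_)
      change _ = ‖f‖ * ‖C • divWeight hlam (ENNReal.conjExponent p) ψ‖
      rw [norm_smul, Real.norm_of_nonneg hC0]
      ring

theorem powerEmbedding_apply (hlam : -1 < lam) (p : ℝ≥0∞) [Fact (1 ≤ p)]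
    (f : Lp ℂ p (nu lam)) (ψ : 𝓓(posHalfLine, ℝ)) :
    (powerEmbedding hlam p).toDist f ψ = ∫ y in Ioi (0 : ℝ), f y * (ψ y : ℂ) :=
  lpMulPairing_divWeight hlam p f ψ

end PowerWeight

/-! ### Exponentials in `L^p(ν_λ)` -/

section PowerWeightExp

variable {lam : ℝ}

/-- The exponent is left as `lam + 1 - 1` to match the Gamma integral with parameter `lam + 1`. -/
theorem enorm_exp_rpow_mul (hlam : -1 < lam) {p : ℝ≥0∞} (ξ : ℝ) {y : ℝ} (hy : 0 < y) :
    ENNReal.ofReal (powerWeight lam y) * ‖(Real.exp (-(2 * Real.pi * ξ * y)) : ℂ)‖ₑ ^ p.toReal =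
      ENNReal.ofReal (((lam + 1) * 2 ^ lam) *
        (y ^ (lam + 1 - 1) * Real.exp (-(2 * Real.pi * p.toReal * ξ * y)))) := by
  have h1 : ‖(Real.exp (-(2 * Real.pi * ξ * y)) : ℂ)‖ₑ =
      ENNReal.ofReal (Real.exp (-(2 * Real.pi * ξ * y))) := by
    rw [← ofReal_norm, Complex.norm_real, Real.norm_of_nonneg (Real.exp_pos _).le]
  rw [h1, ENNReal.ofReal_rpow_of_pos (Real.exp_pos _), ← Real.exp_mul,
    ← ENNReal.ofReal_mul (powerWeight_pos hlam hy).le, powerWeight,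
    Real.mul_rpow two_pos.le hy.le, add_sub_cancel_right]
  congr 1
  rw [show -(2 * Real.pi * ξ * y) * p.toReal = -(2 * Real.pi * p.toReal * ξ * y) by ring]
  ring

theorem lintegral_exp_nu (hlam : -1 < lam) {p : ℝ≥0∞} (ξ : ℝ) :
    ∫⁻ y, ‖(Real.exp (-(2 * Real.pi * ξ * y)) : ℂ)‖ₑ ^ p.toReal ∂nu lam =
      ∫⁻ y in Ioi 0, ENNReal.ofReal (((lam + 1) * 2 ^ lam) *
        (y ^ (lam + 1 - 1) * Real.exp (-(2 * Real.pi * p.toReal * ξ * y)))) := by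
  rw [nu_eq, lintegral_withDensity_eq_lintegral_mul _ (measurable_ofReal_powerWeight lam)
    (by fun_prop)]
  exact setLIntegral_congr_fun measurableSet_Ioi fun y hy => enorm_exp_rpow_mul hlam ξ hy

theorem lintegral_exp_nu_of_pos (hlam : -1 < lam) {p : ℝ≥0∞} (hp : 0 < p.toReal) {ξ : ℝ}
    (hξ : 0 < ξ) :
    ∫⁻ y, ‖(Real.exp (-(2 * Real.pi * ξ * y)) : ℂ)‖ₑ ^ p.toReal ∂nu lam =
      ENNReal.ofReal (ξ ^ (-(lam + 1)) *
        (2 ^ lam * Real.Gamma (lam + 2) / (2 * Real.pi * p.toReal) ^ (lam + 1))) := by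
  have hr : 0 < 2 * Real.pi * p.toReal * ξ := by positivity
  have hl : 0 < lam + 1 := by linarith
  have hint : IntegrableOn (fun y : ℝ => y ^ (lam + 1 - 1) *
      Real.exp (-(2 * Real.pi * p.toReal * ξ * y))) (Ioi 0) := by
    have := integrableOn_rpow_mul_exp_neg_mul_rpow (p := 1) (s := lam + 1 - 1) (by linarith)
      one_pos hr
    simpa only [Real.rpow_one, neg_mul] using this
  rw [lintegral_exp_nu hlam, ← ofReal_integral_eq_lintegral_ofReal (hint.const_mul _),
    integral_const_mul, Real.integral_rpow_mul_exp_neg_mul_Ioi hl hr]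
  · congr 1
    -- The factor `λ + 1` of the density is absorbed by `Γ(λ + 2) = (λ + 1) Γ(λ + 1)`.
    rw [show lam + 2 = (lam + 1) + 1 by ring, Real.Gamma_add_one hl.ne', one_div,
      Real.inv_rpow hr.le, Real.mul_rpow (by positivity) hξ.le, Real.rpow_neg hξ.le]
    field_simp
  · filter_upwards [ae_restrict_mem measurableSet_Ioi] with y hy
    have : (0 : ℝ) < y := hy
    simp only [Pi.zero_apply]
    positivity

theorem eLpNorm_exp_nu (hlam : -1 < lam) {p : ℝ≥0∞} (hp0 : p ≠ 0) (hp : p ≠ ∞) {ξ : ℝ}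
    (hξ : 0 < ξ) :
    eLpNorm (fun y : ℝ => (Real.exp (-(2 * Real.pi * ξ * y)) : ℂ)) p (nu lam) =
      ENNReal.ofReal (ξ ^ (-((lam + 1) / p.toReal)) *
        (2 ^ lam * Real.Gamma (lam + 2) / (2 * Real.pi * p.toReal) ^ (lam + 1)) ^
          (1 / p.toReal)) := by
  have hpr := ENNReal.toReal_pos hp0 hp
  have hG : 0 < Real.Gamma (lam + 2) := Real.Gamma_pos_of_pos (by linarith)
  rw [eLpNorm_eq_lintegral_rpow_enorm_toReal hp0 hp, lintegral_exp_nu_of_pos hlam hpr hξ,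
    ENNReal.ofReal_rpow_of_nonneg (by positivity) (by positivity),
    Real.mul_rpow (by positivity) (by positivity), ← Real.rpow_mul hξ.le]
  congr 3
  ring

theorem memLp_exp_nu (hlam : -1 < lam) {p : ℝ≥0∞} (hp0 : p ≠ 0) (hp : p ≠ ∞) {ξ : ℝ}
    (hξ : 0 < ξ) :
    MemLp (fun y : ℝ => (Real.exp (-(2 * Real.pi * ξ * y)) : ℂ)) p (nu lam) :=
  ⟨Continuous.aestronglyMeasurable (by fun_prop),
    by rw [eLpNorm_exp_nu hlam hp0 hp hξ]; exact ENNReal.ofReal_lt_top⟩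

/-- For `ξ ≤ 0` the exponential is at least `1`, so a finite norm would make `y ^ λ` integrable on
`(1, ∞)`, forcing `λ < -1`. -/
theorem not_memLp_exp_nu (hlam : -1 < lam) {p : ℝ≥0∞} (hp0 : p ≠ 0) (hp : p ≠ ∞) {ξ : ℝ}
    (hξ : ξ ≤ 0) :
    ¬MemLp (fun y : ℝ => (Real.exp (-(2 * Real.pi * ξ * y)) : ℂ)) p (nu lam) := by
  intro h
  have hpr := ENNReal.toReal_pos hp0 hp
  have hl : 0 < lam + 1 := by linarith
  have h1 := lintegral_rpow_enorm_lt_top_of_eLpNorm_lt_top hp0 hp h.2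
  rw [lintegral_exp_nu hlam] at h1
  have h2 : IntegrableOn (fun y : ℝ => ((lam + 1) * 2 ^ lam) *
      (y ^ (lam + 1 - 1) * Real.exp (-(2 * Real.pi * p.toReal * ξ * y)))) (Ioi 0) := by
    refine ⟨Measurable.aestronglyMeasurable (by fun_prop), ?_⟩
    rw [hasFiniteIntegral_iff_ofReal]
    · exact h1
    · filter_upwards [ae_restrict_mem measurableSet_Ioi] with y hy
      have : (0 : ℝ) < y := hy
      simp only [Pi.zero_apply]
      positivity
  have h3 : IntegrableOn (fun y : ℝ => y ^ lam) (Ioi 1) := by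
    have h4 := (h2.mono_set (Ioi_subset_Ioi zero_le_one)).const_mul ((lam + 1) * 2 ^ lam)⁻¹
    refine Integrable.mono h4 (Measurable.aestronglyMeasurable (by fun_prop)) ?_
    filter_upwards [ae_restrict_mem measurableSet_Ioi] with y hy
    have hy0 : (0 : ℝ) < y := zero_lt_one.trans hy
    have hc : ((lam + 1) * 2 ^ lam) ≠ 0 := by positivity
    rw [inv_mul_cancel_left₀ hc, add_sub_cancel_right, norm_mul]
    refine le_mul_of_one_le_right (norm_nonneg _) ?_
    rw [Real.norm_of_nonneg (Real.exp_pos _).le, Real.one_le_exp_iff, neg_nonneg]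
    exact mul_nonpos_of_nonpos_of_nonneg
      (mul_nonpos_of_nonneg_of_nonpos (by positivity) hξ) hy0.le
  have := (integrableOn_Ioi_rpow_iff one_pos).1 h3
  linarith

theorem integrableOn_mul_testFunction {f : ℝ → ℂ} (hf : LocallyIntegrableOn f (Ioi 0))
    (ψ : 𝓓(posHalfLine, ℝ)) : IntegrableOn (fun y => f y * (ψ y : ℂ)) (Ioi 0) := by
  have h := (ψ.integrable_bilin (ContinuousLinearMap.lsmul ℝ ℝ (E := ℂ)) hf).integrableOn
    (s := Ioi 0)
  refine h.congr_fun (fun y _ => ?_) measurableSet_Ioi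
  simp [mul_comm]

/-- Both functions are locally integrable on the half-line, so equal distributions mean equality
almost everywhere; `ν_λ` and Lebesgue measure have the same null sets there. -/
theorem isExp_powerEmbedding_iff (hlam : -1 < lam) {p : ℝ≥0∞} [Fact (1 ≤ p)] {ξ : ℝ}
    {x : Lp ℂ p (nu lam)} : IsExp (powerEmbedding hlam p) ξ x ↔
      x =ᵐ[nu lam] fun y => (Real.exp (-(2 * Real.pi * ξ * y)) : ℂ) := by
  have hx := locallyIntegrableOn_of_memLp hlam Fact.out (Lp.memLp x)
  have he : LocallyIntegrableOn (fun y : ℝ => (Real.exp (-(2 * Real.pi * ξ * y)) : ℂ)) (Ioi 0) :=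
    (Continuous.locallyIntegrable (by fun_prop)).locallyIntegrableOn _
  constructor
  · intro h
    have hz := ae_eq_zero_of_forall_testFunction (hx.sub he) fun ψ => by
      have h1 := h ψ
      rw [powerEmbedding_apply, expPairing, ← sub_eq_zero, ← integral_sub] at h1
      · rw [← h1]
        simp [sub_mul]
      · exact integrableOn_mul_testFunction hx ψ
      · exact integrableOn_mul_testFunction he ψ
    refine (ae_nu_iff hlam).2 ?_
    filter_upwards [hz] with y hy
    exact sub_eq_zero.1 hy
  · intro h ψ
    rw [powerEmbedding_apply, expPairing]
    refine integral_congr_ae ?_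
    filter_upwards [(ae_nu_iff hlam).1 h] with y hy
    rw [hy]

end PowerWeightExp

/-! ### The weight `ρ` of `L^p(ν_λ)` and continuity of the normalized exponentials -/

section PowerWeightRho

variable {lam : ℝ}

/-- The constant in the formula for `rho (powerEmbedding hlam p)`. -/
def rhoConst (lam : ℝ) (p : ℝ≥0∞) : ℝ :=
  (2 ^ lam * Real.Gamma (lam + 2) / (2 * Real.pi * p.toReal) ^ (lam + 1)) ^ (1 / p.toReal)

theorem rhoConst_pos (hlam : -1 < lam) {p : ℝ≥0∞} (hp0 : p ≠ 0) (hp : p ≠ ∞) :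
    0 < rhoConst lam p := by
  have hpr := ENNReal.toReal_pos hp0 hp
  have hG : 0 < Real.Gamma (lam + 2) := Real.Gamma_pos_of_pos (by linarith)
  unfold rhoConst
  positivity

theorem ne_zero_of_fact_one_le (p : ℝ≥0∞) [h : Fact (1 ≤ p)] : p ≠ 0 :=
  (zero_lt_one.trans_le h.out).ne'

/-- The exponential `e^{-2πξ·}` as an element of `L^p(nu lam)`. -/
def powerExp (hlam : -1 < lam) {p : ℝ≥0∞} (hp0 : p ≠ 0) (hp : p ≠ ∞) {ξ : ℝ} (hξ : 0 < ξ) :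
    Lp ℂ p (nu lam) := (memLp_exp_nu hlam hp0 hp hξ).toLp _

theorem powerExp_coeFn (hlam : -1 < lam) {p : ℝ≥0∞} (hp0 : p ≠ 0) (hp : p ≠ ∞) {ξ : ℝ}
    (hξ : 0 < ξ) : powerExp hlam hp0 hp hξ =ᵐ[nu lam]
      fun y => (Real.exp (-(2 * Real.pi * ξ * y)) : ℂ) := MemLp.coeFn_toLp _

theorem isExp_powerExp (hlam : -1 < lam) {p : ℝ≥0∞} [Fact (1 ≤ p)] (hp : p ≠ ∞) {ξ : ℝ}
    (hξ : 0 < ξ) :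
    IsExp (powerEmbedding hlam p) ξ (powerExp hlam (ne_zero_of_fact_one_le p) hp hξ) :=
  (isExp_powerEmbedding_iff hlam).2 (powerExp_coeFn hlam _ hp hξ)

theorem not_exists_isExp_powerEmbedding (hlam : -1 < lam) {p : ℝ≥0∞} [Fact (1 ≤ p)] (hp : p ≠ ∞)
    {ξ : ℝ} (hξ : ξ ≤ 0) : ¬∃ x, IsExp (powerEmbedding hlam p) ξ x := by
  rintro ⟨x, hx⟩
  exact not_memLp_exp_nu hlam (ne_zero_of_fact_one_le p) hp hξ
    ((Lp.memLp x).ae_eq ((isExp_powerEmbedding_iff hlam).1 hx))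

theorem rho_powerEmbedding_of_nonpos (hlam : -1 < lam) {p : ℝ≥0∞} [Fact (1 ≤ p)] (hp : p ≠ ∞)
    {ξ : ℝ} (hξ : ξ ≤ 0) : rho (powerEmbedding hlam p) ξ = ∞ :=
  rho_eq_top_of_not_exists (not_exists_isExp_powerEmbedding hlam hp hξ)

theorem rho_powerEmbedding_of_pos (hlam : -1 < lam) {p : ℝ≥0∞} [Fact (1 ≤ p)] (hp : p ≠ ∞)
    {ξ : ℝ} (hξ : 0 < ξ) : rho (powerEmbedding hlam p) ξ =
      ENNReal.ofReal (ξ ^ (-((lam + 1) / p.toReal)) * rhoConst lam p) := by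
  rw [(isExp_powerExp hlam hp hξ).rho_eq, powerExp, Lp.enorm_toLp,
    eLpNorm_exp_nu hlam (ne_zero_of_fact_one_le p) hp hξ, rhoConst]

/-- One formula covers both signs of `ξ`: the exponent is positive, so the power of `0` matches `1/∞
= 0`, and continuity at `0` becomes visible. -/
theorem inv_rho_powerEmbedding (hlam : -1 < lam) {p : ℝ≥0∞} [Fact (1 ≤ p)] (hp : p ≠ ∞) (ξ : ℝ) :
    ((rho (powerEmbedding hlam p) ξ)⁻¹).toReal =
      max ξ 0 ^ ((lam + 1) / p.toReal) * (rhoConst lam p)⁻¹ := by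
  have hC := rhoConst_pos hlam (ne_zero_of_fact_one_le p) hp
  have ha : 0 < (lam + 1) / p.toReal :=
    div_pos (by linarith) (ENNReal.toReal_pos (ne_zero_of_fact_one_le p) hp)
  rcases le_or_gt ξ 0 with h | h
  · rw [rho_powerEmbedding_of_nonpos hlam hp h, max_eq_right h, Real.zero_rpow ha.ne']
    simp
  · rw [rho_powerEmbedding_of_pos hlam hp h, max_eq_left h.le, ENNReal.toReal_inv,
      ENNReal.toReal_ofReal (by positivity), mul_inv, Real.rpow_neg h.le, inv_inv]

theorem continuous_inv_rho_powerEmbedding (hlam : -1 < lam) {p : ℝ≥0∞} [Fact (1 ≤ p)]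
    (hp : p ≠ ∞) : Continuous fun ξ => ((rho (powerEmbedding hlam p) ξ)⁻¹).toReal := by
  have ha : 0 < (lam + 1) / p.toReal :=
    div_pos (by linarith) (ENNReal.toReal_pos (ne_zero_of_fact_one_le p) hp)
  simp only [inv_rho_powerEmbedding hlam hp]
  exact ((continuous_id.max continuous_const).rpow_const fun _ => Or.inr ha.le).mul
    continuous_const

theorem invRhoLocallyBounded_of_continuous {ι : UniformEmbedding X}
    (h : Continuous fun ξ => ((rho ι ξ)⁻¹).toReal) : InvRhoLocallyBounded ι := by
  intro K hK
  obtain ⟨C, hC⟩ := hK.exists_bound_of_continuousOn h.continuousOn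
  exact memLp_top_of_bound h.aestronglyMeasurable C (ae_restrict_of_forall_mem hK.measurableSet hC)

/-- Raise `t ≤ e^t` with `t = cξ/a` to the power `a`. -/
theorem rpow_mul_exp_neg_le {a c ξ : ℝ} (ha : 0 < a) (hc : 0 < c) (hξ : 0 ≤ ξ) :
    Real.exp (-(c * ξ)) * ξ ^ a ≤ (a / c) ^ a := by
  have h1 : c * ξ / a ≤ Real.exp (c * ξ / a) := by linarith [Real.add_one_le_exp (c * ξ / a)]
  have h2 := Real.rpow_le_rpow (by positivity) h1 ha.le
  rw [← Real.exp_mul, div_mul_cancel₀ _ ha.ne'] at h2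
  have h3 : ξ ^ a = (a / c) ^ a * (c * ξ / a) ^ a := by
    rw [← Real.mul_rpow (by positivity) (by positivity)]
    congr 1
    field_simp
  rw [h3, Real.exp_neg, inv_mul_le_iff₀ (Real.exp_pos _), mul_comm (Real.exp _)]
  gcongr

theorem expDivRhoBounded_powerEmbedding (hlam : -1 < lam) {p : ℝ≥0∞} [Fact (1 ≤ p)]
    (hp : p ≠ ∞) {y₀ : ℝ} (hy₀ : 0 < y₀) : ExpDivRhoBounded (powerEmbedding hlam p) y₀ := by
  have ha : 0 < (lam + 1) / p.toReal :=
    div_pos (by linarith) (ENNReal.toReal_pos (ne_zero_of_fact_one_le p) hp)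
  have hC := rhoConst_pos hlam (ne_zero_of_fact_one_le p) hp
  have hcont := continuous_inv_rho_powerEmbedding hlam hp
  refine memLp_top_of_bound (Continuous.aestronglyMeasurable (by fun_prop))
    (((lam + 1) / p.toReal / (2 * Real.pi * y₀)) ^ ((lam + 1) / p.toReal) * (rhoConst lam p)⁻¹)
    (ae_of_all _ fun ξ => ?_)
  rw [Real.norm_of_nonneg (by positivity), inv_rho_powerEmbedding hlam hp, ← mul_assoc]
  refine mul_le_mul_of_nonneg_right ?_ (by positivity)
  rcases le_or_gt ξ 0 with h | h
  · rw [max_eq_right h, Real.zero_rpow ha.ne', mul_zero]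
    positivity
  · rw [max_eq_left h.le, mul_right_comm (2 * Real.pi)]
    exact rpow_mul_exp_neg_le ha (by positivity) h.le

theorem abs_exp_neg_sub_exp_neg_le {a b m : ℝ} (ha : m ≤ a) (hb : m ≤ b) :
    |Real.exp (-a) - Real.exp (-b)| ≤ |a - b| * Real.exp (-m) := by
  wlog h : a ≤ b generalizing a b
  · rw [abs_sub_comm, abs_sub_comm a]
    exact this hb ha (le_of_not_ge h)
  rw [abs_of_nonneg (sub_nonneg.2 (Real.exp_le_exp.2 (neg_le_neg h))), abs_of_nonpos (by linarith)]
  have h1 : Real.exp (-b) = Real.exp (-a) * Real.exp (-(b - a)) := by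
    rw [← Real.exp_add]
    congr 1
    ring
  have h2 := Real.add_one_le_exp (-(b - a))
  have h3 : Real.exp (-a) ≤ Real.exp (-m) := Real.exp_le_exp.2 (neg_le_neg ha)
  calc Real.exp (-a) - Real.exp (-b) = Real.exp (-a) * (1 - Real.exp (-(b - a))) := by
        rw [h1]
        ring
    _ ≤ Real.exp (-m) * (b - a) :=
        mul_le_mul h3 (by linarith)
          (sub_nonneg.2 (Real.exp_le_one_iff.2 (by linarith))) (Real.exp_pos _).le
    _ = -(a - b) * Real.exp (-m) := by ring

/-- The mean value bound produces a factor `2πy`, which half of the decay `e^{-2πξ₀y}` absorbs; the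
remaining half is an exponential still in `L^p(ν_λ)`. -/
theorem norm_powerExp_sub_le (hlam : -1 < lam) {p : ℝ≥0∞} (hp0 : p ≠ 0) (hp : p ≠ ∞)
    {ξ₀ ξ η : ℝ} (hξ₀ : 0 < ξ₀) (hξ : ξ₀ ≤ ξ) (hη : ξ₀ ≤ η) :
    ‖powerExp hlam hp0 hp (hξ₀.trans_le hξ) - powerExp hlam hp0 hp (hξ₀.trans_le hη)‖ ≤
      |ξ - η| * (2 / ξ₀) * ‖powerExp hlam hp0 hp (half_pos hξ₀)‖ := by
  refine Lp.norm_le_mul_norm_of_ae_le_mul ?_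
  filter_upwards [Lp.coeFn_sub (powerExp hlam hp0 hp (hξ₀.trans_le hξ))
    (powerExp hlam hp0 hp (hξ₀.trans_le hη)), powerExp_coeFn hlam hp0 hp (hξ₀.trans_le hξ),
    powerExp_coeFn hlam hp0 hp (hξ₀.trans_le hη), powerExp_coeFn hlam hp0 hp (half_pos hξ₀),
    (ae_nu_iff hlam).2 (ae_restrict_mem measurableSet_Ioi)] with y h1 h2 h3 h4 hy
  have hy0 : 0 < y := hy
  rw [h1, Pi.sub_apply, h2, h3, h4, ← Complex.ofReal_sub, Complex.norm_real, Complex.norm_real,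
    Real.norm_eq_abs, Real.norm_of_nonneg (Real.exp_pos _).le]
  refine (abs_exp_neg_sub_exp_neg_le (m := 2 * Real.pi * ξ₀ * y) (by gcongr) (by gcongr)).trans ?_
  have h5 : |2 * Real.pi * ξ * y - 2 * Real.pi * η * y| = |ξ - η| * (2 * Real.pi * y) := by
    rw [show 2 * Real.pi * ξ * y - 2 * Real.pi * η * y = (ξ - η) * (2 * Real.pi * y) by ring,
      abs_mul, abs_of_pos (show 0 < 2 * Real.pi * y by positivity)]
  rw [h5, mul_assoc |ξ - η|, mul_assoc |ξ - η|]
  refine mul_le_mul_of_nonneg_left ?_ (abs_nonneg (ξ - η))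
  have h6 : 2 * Real.pi * y ≤ 2 / ξ₀ * Real.exp (2 * Real.pi * (ξ₀ / 2) * y) := by
    rw [div_mul_eq_mul_div, le_div_iff₀ hξ₀]
    linarith [Real.add_one_le_exp (2 * Real.pi * (ξ₀ / 2) * y)]
  calc 2 * Real.pi * y * Real.exp (-(2 * Real.pi * ξ₀ * y))
      ≤ 2 / ξ₀ * Real.exp (2 * Real.pi * (ξ₀ / 2) * y) * Real.exp (-(2 * Real.pi * ξ₀ * y)) := by
        gcongr
    _ = 2 / ξ₀ * Real.exp (-(2 * Real.pi * (ξ₀ / 2) * y)) := by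
        rw [mul_assoc, ← Real.exp_add]
        congr 2
        ring

theorem continuousOn_normalizedExp_powerEmbedding (hlam : -1 < lam) {p : ℝ≥0∞} [Fact (1 ≤ p)]
    (hp : p ≠ ∞) : ContinuousOn (normalizedExp (powerEmbedding hlam p)) {0}ᶜ := by
  have hp0 := ne_zero_of_fact_one_le p
  intro ξ hξ
  refine ContinuousAt.continuousWithinAt ?_
  rcases lt_or_gt_of_ne (show ξ ≠ 0 from hξ) with h | h
  · refine (continuousAt_const (y := (0 : Lp ℂ p (nu lam)))).congr ?_
    filter_upwards [Iio_mem_nhds h] with η hη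
    exact (normalizedExp_of_not_exists
      (not_exists_isExp_powerEmbedding hlam hp (le_of_lt hη))).symm
  -- A total function is needed to speak of continuity at `ξ`; the value `0` for `η ≤ 0` plays no
  -- role near `ξ > 0`. The Lipschitz estimate is used with `ξ₀ = ξ / 2`.
  · let E : ℝ → Lp ℂ p (nu lam) := fun η =>
      if hη : 0 < η then powerExp hlam hp0 hp hη else 0
    have hE : ∀ η (hη : 0 < η), E η = powerExp hlam hp0 hp hη := fun η hη => dif_pos hη
    have hEc : ContinuousAt E ξ := by
      rw [ContinuousAt, tendsto_iff_norm_sub_tendsto_zero]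
      have hlim : Tendsto (fun η => |η - ξ| * (2 / (ξ / 2)) *
          ‖powerExp hlam hp0 hp (half_pos (half_pos h))‖) (𝓝 ξ) (𝓝 0) := by
        have : Continuous fun η : ℝ => |η - ξ| * (2 / (ξ / 2)) *
          ‖powerExp hlam hp0 hp (half_pos (half_pos h))‖ := by fun_prop
        exact this.tendsto' ξ 0 (by simp)
      refine squeeze_zero' (Eventually.of_forall fun _ => norm_nonneg _) ?_ hlim
      filter_upwards [Ioi_mem_nhds (half_lt_self h)] with η hη
      rw [hE η ((half_pos h).trans hη), hE ξ h]
      exact norm_powerExp_sub_le hlam hp0 hp (half_pos h) (le_of_lt hη) (half_le_self h.le)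
    have hE0 : ‖E ξ‖ ≠ 0 := by
      have h1 := rho_ne_zero (powerEmbedding hlam p) ξ
      rw [(isExp_powerExp hlam hp h).rho_eq, ← hE ξ h] at h1
      simpa using h1
    have hN : ContinuousAt (fun η => ((‖E η‖ : ℂ)⁻¹) • E η) ξ :=
      ((Complex.continuous_ofReal.continuousAt.comp hEc.norm).inv₀
        (by simpa using hE0)).smul hEc
    refine hN.congr ?_
    filter_upwards [Ioi_mem_nhds h] with η hη
    rw [(isExp_powerExp hlam hp hη).normalizedExp_eq, hE η hη]

theorem aestronglyMeasurable_of_continuousOn_compl_zero {E : Type*} [NormedAddCommGroup E]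
    {f : ℝ → E} (h : ContinuousOn f {0}ᶜ) : AEStronglyMeasurable f (volume : Measure ℝ) := by
  have h1 := h.aestronglyMeasurable (μ := volume) (measurableSet_singleton 0).compl
  rwa [restrict_compl_singleton] at h1

end PowerWeightRho

end MixedFourier

end

/-! ### Assembly of the general statements and the example -/

theorem mainTheorem3 (q : ℝ≥0∞) [Fact (1 ≤ q)] (hq : q ≠ ∞) :
    (∀ (X : Type*) [NormedAddCommGroup X] [NormedSpace ℂ X] [CompleteSpace X]
        (ι : MixedFourier.UniformEmbedding X),
      -- the Fourier transform is an isometric isomorphism of the mixed-norm space onto `L^q(ℝ, X)`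
      (∃ Φ : MixedFourier.MixedSpace ι q ≃ₗᵢ[ℂ] Lp X q (volume : Measure ℝ),
        ∀ u, Φ u = MixedFourier.transform ι q u) ∧
      -- completeness of the weighted space
      (MixedFourier.InvRhoLocallyBounded ι → CompleteSpace (MixedFourier.weightedSpace ι q)) ∧
      -- every holomorphic element has the form `û(ξ, y) = e^{-2πξy} û₀(ξ)` with a unique `û₀`
      (∀ u : MixedFourier.bergmanSpace ι q, ∃! g : MixedFourier.weightedSpace ι q,
        MixedFourier.IsSymbol u g) ∧
      -- the isometric isomorphism `u ↦ û₀`, and completeness of the holomorphic space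
      (AEStronglyMeasurable (MixedFourier.normalizedExp ι) (volume : Measure ℝ) →
        (∃ Φ : MixedFourier.bergmanSpace ι q ≃ₗᵢ[ℂ] MixedFourier.weightedSpace ι q,
          ∀ u, MixedFourier.IsSymbol u (Φ u)) ∧
        (MixedFourier.InvRhoLocallyBounded ι →
          CompleteSpace (MixedFourier.bergmanSpace ι q))) ∧
      -- the Paley-Wiener-type properties
      ((∀ᵐ ξ : ℝ, ξ < 0 → MixedFourier.rho ι ξ = ∞) →
        MixedFourier.SupportProperty ι q ∧
        ∀ y₀ : ℝ, 0 ≤ y₀ → MixedFourier.ExpDivRhoBounded ι y₀ →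
          ∀ y₁ : ℝ, y₀ < y₁ → MixedFourier.BoundednessProperty ι q y₁)) ∧
    -- the example `X = L^p(ℝ₊, ν_λ)`
    (∀ (lam : ℝ), -1 < lam → ∀ (p : ℝ≥0∞) [Fact (1 ≤ p)], p ≠ ∞ →
      ∃ ι : MixedFourier.UniformEmbedding (Lp ℂ p (MixedFourier.nu lam)),
        (∀ (f : Lp ℂ p (MixedFourier.nu lam)) (ψ : 𝓓(MixedFourier.posHalfLine, ℝ)),
          ι.toDist f ψ = ∫ y in Ioi (0 : ℝ), f y * (ψ y : ℂ)) ∧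
        (∀ ξ : ℝ, 0 < ξ → MixedFourier.rho ι ξ = ENNReal.ofReal
          (ξ ^ (-((lam + 1) / p.toReal)) *
            (2 ^ lam * Real.Gamma (lam + 2) / (2 * Real.pi * p.toReal) ^ (lam + 1)) ^
              (1 / p.toReal))) ∧
        (∀ ξ : ℝ, ξ ≤ 0 → MixedFourier.rho ι ξ = ∞) ∧
        Continuous (fun ξ => ((MixedFourier.rho ι ξ)⁻¹).toReal) ∧
        MixedFourier.InvRhoLocallyBounded ι ∧
        ContinuousOn (MixedFourier.normalizedExp ι) {0}ᶜ ∧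
        AEStronglyMeasurable (MixedFourier.normalizedExp ι) (volume : Measure ℝ) ∧
        (∀ y₀ : ℝ, 0 < y₀ → MixedFourier.ExpDivRhoBounded ι y₀) ∧
        (∃ Φ : MixedFourier.bergmanSpace ι q ≃ₗᵢ[ℂ] MixedFourier.weightedSpace ι q,
          ∀ u, MixedFourier.IsSymbol u (Φ u)) ∧
        CompleteSpace (MixedFourier.weightedSpace ι q) ∧
        CompleteSpace (MixedFourier.bergmanSpace ι q) ∧
        MixedFourier.SupportProperty ι q ∧
        ∀ y₁ : ℝ, 0 < y₁ → MixedFourier.BoundednessProperty ι q y₁) := by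
  refine ⟨?_, ?_⟩
  · intro X _ _ _ ι
    refine ⟨⟨MixedFourier.transformEquiv ι q, fun _ => rfl⟩,
      MixedFourier.completeSpace_weightedSpace q, MixedFourier.existsUnique_isSymbol,
      fun hn => ⟨⟨MixedFourier.symbolEquiv q hn, MixedFourier.isSymbol_symbolMap⟩,
        MixedFourier.completeSpace_bergmanSpace hn⟩,
      fun hρ => ⟨MixedFourier.supportProperty hρ, fun y₀ hy₀ _ y₁ hy₁ =>
        MixedFourier.boundednessProperty hρ (hy₀.trans_lt hy₁)⟩⟩
  · intro lam hlam p _ hp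
    have hinv := MixedFourier.continuous_inv_rho_powerEmbedding hlam hp
    have hloc := MixedFourier.invRhoLocallyBounded_of_continuous hinv
    have hc := MixedFourier.continuousOn_normalizedExp_powerEmbedding hlam hp
    have hn := MixedFourier.aestronglyMeasurable_of_continuousOn_compl_zero hc
    have hρ : ∀ᵐ ξ : ℝ, ξ < 0 → MixedFourier.rho (MixedFourier.powerEmbedding hlam p) ξ = ∞ :=
      ae_of_all _ fun ξ hξ => MixedFourier.rho_powerEmbedding_of_nonpos hlam hp hξ.le
    exact ⟨MixedFourier.powerEmbedding hlam p, MixedFourier.powerEmbedding_apply hlam p,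
      fun ξ hξ => MixedFourier.rho_powerEmbedding_of_pos hlam hp hξ,
      fun ξ hξ => MixedFourier.rho_powerEmbedding_of_nonpos hlam hp hξ, hinv, hloc, hc, hn,
      fun y₀ hy₀ => MixedFourier.expDivRhoBounded_powerEmbedding hlam hp hy₀,
      ⟨MixedFourier.symbolEquiv q hn, MixedFourier.isSymbol_symbolMap⟩,
      MixedFourier.completeSpace_weightedSpace q hloc,
      MixedFourier.completeSpace_bergmanSpace hn hloc, MixedFourier.supportProperty hρ,
      fun y₁ hy₁ => MixedFourier.boundednessProperty hρ hy₁⟩
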